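/- Let $p$ be a prime and let $G$ be a finite $p$-separable group, i.e. $G$ has a series $1=N_0\le N_1\le\dots\le N_n=G$ of normal subgroups in which every factor $N_{i+1}/N_i$ is a $p$-group or has order prime to $p$. Let $H$ be a $p$-complement of $G$, i.e. a subgroup of order prime to $p$ and of $p$-power index. Let $\Gamma_p(G)$ be the graph whose vertices are the non-central conjugacy classes of $G$ consisting of elements of order not divisible by $p$, two distinct classes being adjacent if and only if their cardinalities are not coprime. Suppose that $\Gamma_p(G)$ has exactly two connected components, each consisting of two adjacent vertices. Then $\mathbf{Z}(H)=H\cap\mathbf{Z}(G)$; the group $H$ is quasi-Frobenius with abelian kernel and complements, i.e. $H/\mathbf{Z}(H)$ is a Frobenius group and the inverse images in $H$ of its Frobenius kernel and of its Frobenius complements are abelian; the set of prime divisors of $|H|$ is $\{q,r\}$ for two different primes $q$ and $r$, both distinct from $p$; and $\mathbf{Z}(H)$ is either trivial or cyclic of order two. -/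

import Mathlib

/-- A group `G` is `p`-separable if it has a finite series `1 = N₀ ≤ N₁ ≤ ⋯ ≤ Nₙ = G` of normal
subgroups of `G` each of whose factors `Nᵢ₊₁ / Nᵢ` is either a `p`-group or a `p'`-group. The order
of the factor `Nᵢ₊₁ / Nᵢ` is the relative index of `Nᵢ` in `Nᵢ₊₁`. -/
def IsPSeparable (p : ℕ) (G : Type*) [Group G] : Prop :=
  ∃ (n : ℕ) (N : ℕ → Subgroup G),
    N 0 = ⊥ ∧ N n = ⊤ ∧ (∀ i, (N i).Normal) ∧
      ∀ i < n, N i ≤ N (i + 1) ∧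
        ((∃ k : ℕ, (N i).relIndex (N (i + 1)) = p ^ k) ∨
          ((N i).relIndex (N (i + 1))).Coprime p)

/-- A `p`-complement of `G`, that is, a Hall `p'`-subgroup: its order is prime to `p` and its
index is a power of `p`. -/
def IsPComplement (p : ℕ) {G : Type*} [Group G] (H : Subgroup G) : Prop :=
  (Nat.card H).Coprime p ∧ ∃ k : ℕ, H.index = p ^ k

/-- The vertices of `Γ_p(G)`: the non-central conjugacy classes of `G` consisting of `p`-regular
elements (elements whose order is not divisible by `p`). -/
def PRegularNoncentralClass (p : ℕ) (G : Type*) [Group G] : Type _ :=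
  {B : ConjClasses G // B ∈ ConjClasses.noncenter G ∧ ∀ g ∈ B.carrier, ¬ p ∣ orderOf g}

/-- The common divisor graph `Γ_p(G)`: two distinct non-central `p`-regular classes are adjacent
if and only if their lengths are not coprime. -/
def pRegularClassGraph (p : ℕ) (G : Type*) [Group G] :
    SimpleGraph (PRegularNoncentralClass p G) where
  Adj B D := B ≠ D ∧ ¬ (Nat.card B.1.carrier).Coprime (Nat.card D.1.carrier)
  symm := ⟨fun _ _ h => ⟨h.1.symm, fun hc => h.2 hc.symm⟩⟩
  loopless := ⟨fun _ h => h.1 rfl⟩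

/-- `K` is a Frobenius group with kernel `N` and complement `C`: `K = N ⋊ C` with `N` and `C`
non-trivial, and no non-trivial element of `C` fixes (commutes with) a non-trivial element
of `N`. -/
structure IsFrobeniusWith {K : Type*} [Group K] (N C : Subgroup K) : Prop where
  normal : N.Normal
  isComplement : N.IsComplement' C
  kernel_ne_bot : N ≠ ⊥
  complement_ne_bot : C ≠ ⊥
  fixedPointFree : ∀ c ∈ C, ∀ n ∈ N, c ≠ 1 → n ≠ 1 → c * n ≠ n * c

/-- A Frobenius group. -/
def IsFrobeniusGroup (K : Type*) [Group K] : Prop :=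
  ∃ N C : Subgroup K, IsFrobeniusWith N C

/-- `H` is quasi-Frobenius if `H / Z(H)` is a Frobenius group. -/
def IsQuasiFrobenius (H : Type*) [Group H] : Prop :=
  IsFrobeniusGroup (H ⧸ Subgroup.center H)

/-- `H` is quasi-Frobenius with abelian kernel and complements: `H / Z(H)` is a Frobenius group,
and the inverse images in `H` of its kernel and of all its complements are abelian. -/
def IsQuasiFrobeniusAbelian (H : Type*) [Group H] : Prop :=
  IsQuasiFrobenius H ∧
    ∀ N C : Subgroup (H ⧸ Subgroup.center H), IsFrobeniusWith N C →
      IsMulCommutative (N.comap (QuotientGroup.mk' (Subgroup.center H))) ∧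
        IsMulCommutative (C.comap (QuotientGroup.mk' (Subgroup.center H)))

/-! Let U and V be the sets of non-central p-regular elements belonging to the two components.
Lengths of classes from different parts are coprime, and among three elements of one part two are
conjugate.

If b ∈ U and d ∈ V, coprimality makes the product of their classes a single class. When bd ∈ U,
multiplying once more by the class of d⁻¹ leads back to the class of b, which is therefore stable
under right multiplication by every quotient of two conjugates of d. Choose b in H of maximal class
length over both parts, say b ∈ U; then bd ∈ U for every d ∈ H ∩ V. Let N be the normal closure of
the elements of H that lie in V or Z(G). Then M = [G, N] stabilizes the class of b, so |M| divides
the length of b and is prime to all lengths in V. This makes N abelian, contained in H and disjoint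
from U (`ClassSplit.splitKernel`).

Comparing three elements of U or of V at a time, mostly through their orders, yields a prime q such
that q'-elements of N are central, and a prime r ≠ q such that H/N is an r-group
(`SplitKernel.exists_primeKernel`, `PrimeKernel.prime_r_ne_prime_q`). The same method shows that an
element of N commuting with an element of H outside N is central
(`PrimeKernel.mem_center_of_commute`): this is the Frobenius condition, and it gives Z(H) = H ∩
Z(G).

It also forces r-elements to have class length prime to r. A Hall–Higman argument, the only use of
p-separability, then makes r-subgroups abelian (`PrimeKernel.commute_of_isPGroup`), so the
commutators of H lie in M. Since M ∩ Z(G) = 1, the centralizer in H of any c outside N supplements M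
and is a complement to N modulo the centre. Multiplying representatives by central elements bounds
Z(H) (`PrimeKernel.eq_one_of_central`, `PrimeKernel.eq_of_central`). -/

/-- The length of the conjugacy class of `x`. -/
noncomputable def classLength {G : Type*} [Group G] (x : G) : ℕ :=
  (Subgroup.centralizer ({x} : Set G)).index

/-! ### Class lengths, coprime indices and primary parts of elements. -/

section Generic

variable {G : Type*} [Group G]

theorem mem_centralizer_singleton {x g : G} :
    g ∈ Subgroup.centralizer ({x} : Set G) ↔ Commute g x := by
  rw [Subgroup.mem_centralizer_singleton_iff]; exact Iff.rfl

theorem card_carrier_eq_classLength (x : G) :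
    Nat.card (ConjClasses.mk x).carrier = classLength x := by
  rw [← ConjAct.orbit_eq_carrier_conjClasses, classLength, Nat.card_coe_set_eq,
    ← MulAction.index_stabilizer, ConjAct.stabilizer_eq_centralizer]
  rfl

theorem isConj_conj (g x : G) : IsConj x (g * x * g⁻¹) := isConj_iff.2 ⟨g, rfl⟩

theorem classLength_eq_of_isConj {x y : G} (h : IsConj x y) : classLength x = classLength y := by
  rw [← card_carrier_eq_classLength, ← card_carrier_eq_classLength,
    ConjClasses.mk_eq_mk_iff_isConj.2 h]

theorem orderOf_eq_of_isConj {x y : G} (h : IsConj x y) : orderOf x = orderOf y := by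
  obtain ⟨g, rfl⟩ := isConj_iff.1 h
  exact (orderOf_injective (MulAut.conj g).toMonoidHom (MulAut.conj g).injective x).symm

theorem classLength_eq_one_iff {x : G} : classLength x = 1 ↔ x ∈ Subgroup.center G := by
  rw [classLength, Subgroup.index_eq_one, Subgroup.eq_top_iff', Subgroup.mem_center_iff]
  simp only [mem_centralizer_singleton]; rfl

theorem mem_center_iff_of_isConj {x y : G} (h : IsConj x y) :
    x ∈ Subgroup.center G ↔ y ∈ Subgroup.center G := by
  rw [← classLength_eq_one_iff, ← classLength_eq_one_iff, classLength_eq_of_isConj h]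

theorem classLength_inv (x : G) : classLength x⁻¹ = classLength x := by
  have : Subgroup.centralizer ({x⁻¹} : Set G) = Subgroup.centralizer ({x} : Set G) := by
    ext g; simp only [mem_centralizer_singleton, Commute.inv_right_iff]
  rw [classLength, this, classLength]

theorem classLength_dvd_of_le {x y : G}
    (h : ∀ g, Commute g x → Commute g y) : classLength y ∣ classLength x :=
  Subgroup.index_dvd_of_le fun g hg => by
    rw [mem_centralizer_singleton] at *; exact h g hg

theorem classLength_pow_dvd (x : G) (n : ℕ) : classLength (x ^ n) ∣ classLength x :=
  classLength_dvd_of_le fun _ h => h.pow_right n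

variable [Finite G]

theorem index_inf_eq_of_coprime {A B : Subgroup G} (h : A.index.Coprime B.index) :
    (A ⊓ B).index = A.index * B.index := by
  apply le_antisymm Subgroup.index_inf_le
  exact Nat.le_of_dvd (Nat.pos_of_ne_zero Subgroup.index_ne_zero_of_finite)
    (h.mul_dvd_of_dvd_of_dvd (Subgroup.index_dvd_of_le inf_le_left)
      (Subgroup.index_dvd_of_le inf_le_right))

/-- `B` acts on `G ⧸ A` with stabilizer `A ⊓ B` of the base point. Coprimality makes the orbit as
large as `G ⧸ A`, so the action is transitive. -/
theorem exists_mul_eq_of_coprime_index {A B : Subgroup G} (h : A.index.Coprime B.index) (g : G) :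
    ∃ a ∈ A, ∃ b ∈ B, a * b = g := by
  have h1 : A.relIndex B = A.index := by
    have := index_inf_eq_of_coprime h
    rw [← Subgroup.relIndex_mul_index (inf_le_right : A ⊓ B ≤ B), Subgroup.inf_relIndex_right] at this
    exact Nat.eq_of_mul_eq_mul_right (Nat.pos_of_ne_zero Subgroup.index_ne_zero_of_finite) this
  have h2 : MulAction.orbit B ((1 : G) : G ⧸ A) = Set.univ := by
    apply Set.eq_of_subset_of_ncard_le (Set.subset_univ _)
    rw [Set.ncard_univ, ← MulAction.index_stabilizer, ← Subgroup.index_eq_card, ← h1]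
    have : MulAction.stabilizer B ((1 : G) : G ⧸ A) = A.subgroupOf B := by
      ext b
      rw [MulAction.mem_stabilizer_iff, Subgroup.mem_subgroupOf]
      change (((b : G) * 1 : G) : G ⧸ A) = _ ↔ _
      rw [eq_comm, QuotientGroup.eq]; simp
    rw [this]; rfl
  have h3 : ((g⁻¹ : G) : G ⧸ A) ∈ MulAction.orbit B ((1 : G) : G ⧸ A) := h2 ▸ Set.mem_univ _
  obtain ⟨b, hb⟩ := h3
  change (((b : G) * 1 : G) : G ⧸ A) = _ at hb
  rw [QuotientGroup.eq] at hb
  refine ⟨_, A.inv_mem hb, _, B.inv_mem b.2, by simp⟩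

/-- The two centralizers have coprime indices, so G = C(x)C(y), and a single element realises both
conjugations at once. -/
theorem isConj_mul_of_coprime {x y x' y' : G} (h : (classLength x).Coprime (classLength y))
    (hx : IsConj x x') (hy : IsConj y y') : IsConj (x * y) (x' * y') := by
  obtain ⟨g, rfl⟩ := isConj_iff.1 hx
  obtain ⟨k, rfl⟩ := isConj_iff.1 hy
  obtain ⟨a, ha, b, hb, hab⟩ := exists_mul_eq_of_coprime_index h (g⁻¹ * k)
  rw [mem_centralizer_singleton] at ha hb
  refine isConj_iff.2 ⟨g * a, ?_⟩
  have hk : k = g * a * b := by rw [mul_assoc, hab]; group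
  have e1 : a * x * a⁻¹ = x := by rw [ha.eq]; group
  have e2 : b * y * b⁻¹ = y := by rw [hb.eq]; group
  calc g * a * (x * y) * (g * a)⁻¹ = g * (a * x * a⁻¹) * g⁻¹ * (g * a * y * (g * a)⁻¹) := by group
    _ = g * x * g⁻¹ * (g * a * (b * y * b⁻¹) * (g * a)⁻¹) := by rw [e1, e2]
    _ = _ := by rw [hk]; group

omit [Finite G] in
-- The class is a union of left cosets of `W`.
theorem card_dvd_classLength {x : G} {W : Subgroup G}
    (h : ∀ y, IsConj x y → ∀ w ∈ W, IsConj x (y * w)) : Nat.card W ∣ classLength x := by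
  have h1 : ((↑) : G → G ⧸ W) ⁻¹' (((↑) : G → G ⧸ W) '' {y | IsConj x y}) = {y | IsConj x y} := by
    apply Set.Subset.antisymm _ (Set.subset_preimage_image _ _)
    rintro y ⟨z, hz, hzy⟩
    rw [QuotientGroup.eq] at hzy
    simpa using h z hz _ hzy
  rw [← card_carrier_eq_classLength]
  have h2 : (ConjClasses.mk x).carrier = {y | IsConj x y} := by
    ext y
    rw [ConjClasses.mem_carrier_iff_mk_eq, ConjClasses.mk_eq_mk_iff_isConj, isConj_comm]; rfl
  rw [h2, ← h1, Nat.card_congr (QuotientGroup.preimageMkEquivSubgroupProdSet W _), Nat.card_prod]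
  exact dvd_mul_right _ _

theorem exists_pow_primary (x : G) {ℓ : ℕ} (hℓ : ℓ.Prime) :
    ∃ i j : ℕ, (∃ k, orderOf (x ^ i) = ℓ ^ k) ∧ ¬ ℓ ∣ orderOf (x ^ j) ∧ x = x ^ i * x ^ j := by
  obtain ⟨a, m, hm, hn⟩ := Nat.exists_eq_pow_mul_and_not_dvd (orderOf_pos x).ne' ℓ hℓ.ne_one
  have hc : (ℓ ^ a).Coprime m := (hℓ.coprime_iff_not_dvd.2 hm).pow_left a
  obtain ⟨i, hi1, hi2⟩ := Nat.chineseRemainder hc 1 0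
  obtain ⟨j, hj1, hj2⟩ := Nat.chineseRemainder hc 0 1
  have e1 : (x ^ i) ^ ℓ ^ a = 1 := by
    rw [← pow_mul, ← orderOf_dvd_iff_pow_eq_one, hn, mul_comm]
    exact mul_dvd_mul ((Nat.modEq_zero_iff_dvd).1 hi2) dvd_rfl
  have e2 : (x ^ j) ^ m = 1 := by
    rw [← pow_mul, ← orderOf_dvd_iff_pow_eq_one, hn]
    exact mul_dvd_mul ((Nat.modEq_zero_iff_dvd).1 hj1) dvd_rfl
  refine ⟨i, j, ?_, fun h => hm (h.trans (orderOf_dvd_of_pow_eq_one e2)), ?_⟩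
  · obtain ⟨k, -, hk⟩ := (Nat.dvd_prime_pow hℓ).1 (orderOf_dvd_of_pow_eq_one e1)
    exact ⟨k, hk⟩
  · rw [← pow_add]
    conv_lhs => rw [← pow_one x]
    rw [pow_eq_pow_iff_modEq, hn]
    exact (Nat.modEq_and_modEq_iff_modEq_mul hc).1 ⟨(hi1.add hj1).symm, (hi2.add hj2).symm⟩

omit [Finite G] in
-- An ℓ-group acting on `G ⧸ K`, a set of size prime to ℓ, has a fixed point.
theorem exists_conj_mem_of_not_dvd_index {K : Subgroup G} {ℓ : ℕ} (hℓ : ℓ.Prime)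
    (hK : ¬ ℓ ∣ K.index) {y : G} {k : ℕ} (hy : orderOf y = ℓ ^ k) : ∃ g, g * y * g⁻¹ ∈ K := by
  have := Fact.mk hℓ
  have h1 : IsPGroup ℓ (Subgroup.zpowers y) := IsPGroup.of_card (n := k) (by rw [Nat.card_zpowers, hy])
  obtain ⟨c, hc⟩ := h1.nonempty_fixed_point_of_prime_not_dvd_card (G ⧸ K)
    (by rwa [← Subgroup.index_eq_card])
  obtain ⟨g, rfl⟩ := QuotientGroup.mk_surjective c
  have h2 := hc ⟨y, Subgroup.mem_zpowers y⟩
  change ((y * g : G) : G ⧸ K) = g at h2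
  rw [eq_comm, QuotientGroup.eq] at h2
  exact ⟨g⁻¹, by simpa [mul_assoc] using h2⟩

omit [Finite G] in
theorem exists_conj_commute_of_not_dvd {x y : G} {ℓ : ℕ} (hℓ : ℓ.Prime)
    (hx : ¬ ℓ ∣ classLength x) {k : ℕ} (hy : orderOf y = ℓ ^ k) :
    ∃ g, Commute (g * y * g⁻¹) x := by
  obtain ⟨g, hg⟩ := exists_conj_mem_of_not_dvd_index hℓ hx hy
  exact ⟨g, mem_centralizer_singleton.1 hg⟩

/-- As HK is a subgroup, |K : H ∩ K| = |HK : H|. -/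
theorem relIndex_dvd_index_of_right_normal (H K : Subgroup G) [K.Normal] :
    H.relIndex K ∣ H.index := by
  have h1 := Subgroup.relIndex_mul_relIndex (H ⊓ K) H (H ⊔ K) inf_le_left le_sup_left
  have h2 := Subgroup.relIndex_mul_relIndex (H ⊓ K) K (H ⊔ K) inf_le_right le_sup_right
  rw [Subgroup.inf_relIndex_left] at h1
  rw [Subgroup.inf_relIndex_right, Subgroup.relIndex_sup_right, ← h1, mul_comm] at h2
  have h3 : K.relIndex H ≠ 0 := Subgroup.index_ne_zero_of_finite
  rw [Nat.eq_of_mul_eq_mul_left (Nat.pos_of_ne_zero h3) h2]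
  exact Subgroup.relIndex_dvd_index_of_le le_sup_left

theorem le_centralizer_of_coprime {M : Subgroup G} [M.Normal] {x : G}
    (h : (Nat.card M).Coprime (classLength x)) : ∀ m ∈ M, Commute m x := by
  have h1 : (Subgroup.centralizer ({x} : Set G)).relIndex M ∣ classLength x := by
    exact relIndex_dvd_index_of_right_normal _ _
  have h2 := Subgroup.relIndex_eq_one.1
    (Nat.eq_one_of_dvd_coprimes h (Subgroup.relIndex_dvd_card _ M) h1)
  exact fun m hm => mem_centralizer_singleton.1 (h2 hm)

omit [Finite G] in
theorem not_dvd_orderOf_of_mem {p : ℕ} {H : Subgroup G} (hp : p.Prime)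
    (hH : (Nat.card H).Coprime p) {x : G} (hx : x ∈ H) : ¬ p ∣ orderOf x := fun h =>
  hp.coprime_iff_not_dvd.1 hH.symm (h.trans (Subgroup.orderOf_dvd_natCard H hx))

theorem IsPComplement.le_of_normal {p : ℕ} (hp : p.Prime) {H : Subgroup G} (hH : IsPComplement p H)
    {K : Subgroup G} [K.Normal] (hK : ∀ x ∈ K, ¬ p ∣ orderOf x) : K ≤ H := by
  obtain ⟨hH, k, hk⟩ := hH
  have h1 : (Nat.card K).Coprime (p ^ k) := by
    refine Nat.Coprime.pow_right _ (Nat.Coprime.symm (hp.coprime_iff_not_dvd.2 fun hd => ?_))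
    have := Fact.mk hp
    obtain ⟨x, hx⟩ := exists_prime_orderOf_dvd_card' p hd
    exact hK x x.2 (by rw [Subgroup.orderOf_coe, hx])
  have h2 : H.relIndex K ∣ p ^ k := by
    exact hk ▸ relIndex_dvd_index_of_right_normal _ _
  exact Subgroup.relIndex_eq_one.1 (Nat.eq_one_of_dvd_coprimes h1 (Subgroup.relIndex_dvd_card _ _) h2)

end Generic

/-! ### Products of elements from the two parts, and stabilizers of classes. -/

section Split

variable {G : Type*} [Group G]

/-- The `p`-regular non-central elements of `G` are divided into two non-empty sets, each meeting at
most two conjugacy classes, such that class lengths from different sets are coprime. -/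
structure ClassSplit (p : ℕ) (U V : Set G) : Prop where
  regular_left : ∀ x ∈ U, ¬ p ∣ orderOf x
  regular_right : ∀ x ∈ V, ¬ p ∣ orderOf x
  noncentral_left : ∀ x ∈ U, x ∉ Subgroup.center G
  noncentral_right : ∀ x ∈ V, x ∉ Subgroup.center G
  cover : ∀ x : G, ¬ p ∣ orderOf x → x ∉ Subgroup.center G → x ∈ U ∨ x ∈ V
  coprime : ∀ x ∈ U, ∀ y ∈ V, (classLength x).Coprime (classLength y)
  three_left : ∀ x ∈ U, ∀ y ∈ U, ∀ z ∈ U, IsConj x y ∨ IsConj x z ∨ IsConj y z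
  three_right : ∀ x ∈ V, ∀ y ∈ V, ∀ z ∈ V, IsConj x y ∨ IsConj x z ∨ IsConj y z
  nonempty_left : U.Nonempty
  nonempty_right : V.Nonempty

/-- The elements that multiply the conjugacy class of `b` into itself from the right. -/
def classStabilizer (b : G) : Subgroup G where
  carrier := {w | ∀ y, IsConj b (y * w) ↔ IsConj b y}
  one_mem' := by simp
  mul_mem' := by
    intro v w hv hw y
    rw [← mul_assoc, hw, hv]
  inv_mem' := by
    intro w hw y
    rw [← hw (y * w⁻¹), inv_mul_cancel_right]

theorem isConj_conj_iff (g b x : G) : IsConj b (g * x * g⁻¹) ↔ IsConj b x :=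
  ⟨fun h => h.trans (isConj_conj g x).symm, fun h => h.trans (isConj_conj g x)⟩

instance classStabilizer_normal (b : G) : (classStabilizer b).Normal where
  conj_mem := by
    intro w hw g y
    have := hw (g⁻¹ * y * g)
    rw [← isConj_conj_iff g b (g⁻¹ * y * g * w), ← isConj_conj_iff g b (g⁻¹ * y * g)] at this
    simpa [mul_assoc] using this

theorem mem_classStabilizer_of_forall [Finite G] {b w : G}
    (h : ∀ y, IsConj b y → IsConj b (y * w)) : w ∈ classStabilizer b := by
  have hk : ∀ (k : ℕ) y, IsConj b y → IsConj b (y * w ^ k) := by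
    intro k
    induction k with
    | zero => simp
    | succ k ih => exact fun y hy => by rw [pow_succ, ← mul_assoc]; exact h _ (ih y hy)
  intro y
  refine ⟨fun hy => ?_, h y⟩
  have := hk (orderOf w - 1) _ hy
  rwa [mul_assoc, ← pow_succ', Nat.sub_add_cancel (orderOf_pos w), pow_orderOf_eq_one,
    mul_one] at this

theorem card_dvd_classLength_of_le [Finite G] {b : G} {W : Subgroup G}
    (h : W ≤ classStabilizer b) : Nat.card W ∣ classLength b :=
  card_dvd_classLength fun y hy _ hw => (h hw y).2 hy

theorem commutator_top_normalClosure_le {S : Set G} {T : Subgroup G} [T.Normal]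
    (h : ∀ s ∈ S, ∀ g, g * s * g⁻¹ * s⁻¹ ∈ T) :
    ⁅(⊤ : Subgroup G), Subgroup.normalClosure S⁆ ≤ T := by
  have h1 : Subgroup.normalClosure S ≤ (Subgroup.center (G ⧸ T)).comap (QuotientGroup.mk' T) := by
    refine Subgroup.normalClosure_le_normal fun s hs => ?_
    rw [SetLike.mem_coe, Subgroup.mem_comap, Subgroup.mem_center_iff]
    intro c
    obtain ⟨g, rfl⟩ := QuotientGroup.mk_surjective c
    have := h s hs g
    rw [← QuotientGroup.eq_one_iff] at this
    simpa [mul_inv_eq_iff_eq_mul, mul_inv_eq_one] using this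
  rw [Subgroup.commutator_le]
  intro g _ n hn
  have h2 := Subgroup.mem_center_iff.1 (h1 hn) g
  rw [commutatorElement_def, ← QuotientGroup.eq_one_iff]
  simpa [mul_inv_eq_iff_eq_mul, mul_inv_eq_one] using h2

theorem exists_primary_not_mem [Finite G] {K : Subgroup G} : ∀ (x : G), x ∉ K →
    ∃ n ℓ k : ℕ, ℓ.Prime ∧ orderOf (x ^ n) = ℓ ^ k ∧ x ^ n ∉ K := by
  suffices ∀ (m : ℕ) (x : G), orderOf x = m → x ∉ K →
      ∃ n ℓ k : ℕ, ℓ.Prime ∧ orderOf (x ^ n) = ℓ ^ k ∧ x ^ n ∉ K from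
    fun x => this _ x rfl
  intro m
  induction m using Nat.strong_induction_on with
  | _ m ih =>
    intro x hm hx
    have hx1 : orderOf x ≠ 1 := fun h => hx (by
      rw [orderOf_eq_one_iff.1 h]; exact K.one_mem)
    obtain ⟨ℓ, hℓ, hd⟩ := Nat.exists_prime_and_dvd hx1
    obtain ⟨i, j, ⟨k, hk⟩, hj, hij⟩ := exists_pow_primary x hℓ
    by_cases hi : x ^ i ∈ K
    · have hjc : x ^ j ∉ K := fun h => hx (by
        rw [hij]; exact K.mul_mem hi h)
      have hlt : orderOf (x ^ j) < m := by
        rw [← hm]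
        refine lt_of_le_of_ne (Nat.le_of_dvd (orderOf_pos x) (orderOf_pow_dvd j)) ?_
        intro h; rw [h] at hj; exact hj hd
      obtain ⟨n, ℓ', k', h1, h2, h3⟩ := ih _ hlt _ rfl hjc
      exact ⟨j * n, ℓ', k', h1, by rwa [pow_mul], by rwa [pow_mul]⟩
    · exact ⟨i, ℓ, k, hℓ, hk, hi⟩

theorem orderOf_pow_not_dvd {p : ℕ} {x : G} (h : ¬ p ∣ orderOf x) (n : ℕ) :
    ¬ p ∣ orderOf (x ^ n) := fun hd => h (hd.trans (orderOf_pow_dvd n))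

theorem IsPComplement.exists_conj_mem [Finite G] {p : ℕ} (hp : p.Prime) {H : Subgroup G}
    (hH : IsPComplement p H) {ℓ : ℕ} (hℓ : ℓ.Prime) (hne : ℓ ≠ p) {y : G} {k : ℕ}
    (hy : orderOf y = ℓ ^ k) : ∃ g, g * y * g⁻¹ ∈ H := by
  refine exists_conj_mem_of_not_dvd_index hℓ (fun h => ?_) hy
  obtain ⟨m, hm⟩ := hH.2
  rw [hm] at h
  exact hne ((Nat.prime_dvd_prime_iff_eq hℓ hp).1 (hℓ.dvd_of_dvd_pow h))

namespace ClassSplit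

variable {p : ℕ} {U V : Set G}

theorem symm (S : ClassSplit p U V) : ClassSplit p V U where
  regular_left := S.regular_right
  regular_right := S.regular_left
  noncentral_left := S.noncentral_right
  noncentral_right := S.noncentral_left
  cover x h1 h2 := (S.cover x h1 h2).symm
  coprime x hx y hy := (S.coprime y hy x hx).symm
  three_left := S.three_right
  three_right := S.three_left
  nonempty_left := S.nonempty_right
  nonempty_right := S.nonempty_left

theorem mem_left_of_dvd (S : ClassSplit p U V) {x y : G} (hx : x ∈ U) (hy : ¬ p ∣ orderOf y)
    (hyc : y ∉ Subgroup.center G) (h : classLength y ∣ classLength x) : y ∈ U := by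
  refine (S.cover y hy hyc).resolve_right fun hV => hyc ?_
  rw [← classLength_eq_one_iff]
  exact Nat.eq_one_of_dvd_coprimes (S.coprime x hx y hV) h dvd_rfl

theorem mem_left_of_dvd' (S : ClassSplit p U V) {x y : G} (hx : x ∈ U) (hy : ¬ p ∣ orderOf y)
    (hyc : y ∉ Subgroup.center G) (h : classLength x ∣ classLength y) : y ∈ U := by
  refine (S.cover y hy hyc).resolve_right fun hV => S.noncentral_left x hx ?_
  rw [← classLength_eq_one_iff]
  exact Nat.eq_one_of_dvd_coprimes (S.coprime x hx y hV) dvd_rfl h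

theorem mem_left_of_isConj (S : ClassSplit p U V) {x y : G} (hx : x ∈ U) (h : IsConj x y) :
    y ∈ U :=
  S.mem_left_of_dvd hx (orderOf_eq_of_isConj h ▸ S.regular_left x hx)
    (fun hy => S.noncentral_left x hx ((mem_center_iff_of_isConj h).2 hy))
    (classLength_eq_of_isConj h ▸ dvd_rfl)

theorem pow_mem_left (S : ClassSplit p U V) {x : G} (hx : x ∈ U) {n : ℕ}
    (h : x ^ n ∉ Subgroup.center G) : x ^ n ∈ U :=
  S.mem_left_of_dvd hx (orderOf_pow_not_dvd (S.regular_left x hx) n) h (classLength_pow_dvd x n)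

theorem exists_primary_left [Finite G] (S : ClassSplit p U V) (hp : p.Prime) {H : Subgroup G}
    (hH : IsPComplement p H) : ∃ x ∈ U, x ∈ H := by
  obtain ⟨x, hx⟩ := S.nonempty_left
  obtain ⟨n, ℓ, k, hℓ, hk, hc⟩ := exists_primary_not_mem x (S.noncentral_left x hx)
  have hxn := S.pow_mem_left hx hc
  have hne : ℓ ≠ p := by
    rintro rfl
    rcases k with _ | k
    · have h1 : x ^ n = 1 := orderOf_eq_one_iff.1 (by simpa using hk)
      exact hc (h1 ▸ Subgroup.one_mem _)
    · exact S.regular_left _ hxn (by rw [hk]; exact dvd_pow_self _ k.succ_ne_zero)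
  obtain ⟨g, hg⟩ := hH.exists_conj_mem hp hℓ hne hk
  exact ⟨_, S.mem_left_of_isConj hxn (isConj_conj g _), hg⟩

variable [Finite G]

/-- Products of coprime classes are used twice: b'd' is conjugate to bd, and since bd ∈ U has length
coprime to that of d⁻¹, the element b'd'd''⁻¹ is conjugate to bdd⁻¹ = b. -/
theorem isConj_absorb (S : ClassSplit p U V) {b d b' d' d'' : G} (hb : b ∈ U) (hd : d ∈ V)
    (hbd : b * d ∈ U) (h : IsConj b b') (h' : IsConj d d') (h'' : IsConj d d'') :
    IsConj b (b' * (d' * d''⁻¹)) := by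
  have h1 := isConj_mul_of_coprime (S.coprime b hb d hd) h h'
  have h2 : IsConj d⁻¹ d''⁻¹ := by
    obtain ⟨g, rfl⟩ := isConj_iff.1 h''
    exact isConj_iff.2 ⟨g, by group⟩
  have h3 := isConj_mul_of_coprime (x := b * d) (y := d⁻¹)
    (by rw [classLength_inv]; exact S.coprime _ hbd d hd) h1 h2
  simpa [mul_assoc] using h3

theorem mem_classStabilizer (S : ClassSplit p U V) {b d d' d'' : G} (hb : b ∈ U) (hd : d ∈ V)
    (hbd : b * d ∈ U) (h' : IsConj d d') (h'' : IsConj d d'') :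
    d' * d''⁻¹ ∈ classStabilizer b :=
  mem_classStabilizer_of_forall fun _ hy => S.isConj_absorb hb hd hbd hy h' h''

theorem mem_classStabilizer_right (S : ClassSplit p U V) {b d b' b'' : G} (hb : b ∈ U) (hd : d ∈ V)
    (hbd : b * d ∈ V) (h' : IsConj b b') (h'' : IsConj b b'') :
    b' * b''⁻¹ ∈ classStabilizer d := by
  refine S.symm.mem_classStabilizer hd hb ?_ h' h''
  refine S.symm.mem_left_of_isConj hbd (isConj_iff.2 ⟨b⁻¹, by group⟩)

omit [Finite G] in
/-- A `p`-regular product of elements from the two parts lies in one of the parts. -/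
theorem mul_mem_or (S : ClassSplit p U V) {b d : G} (hb : b ∈ U) (hd : d ∈ V)
    (hbd : ¬ p ∣ orderOf (b * d)) : b * d ∈ U ∨ b * d ∈ V := by
  refine S.cover _ hbd fun hc => S.noncentral_left b hb ?_
  have hcomm : ∀ g, Commute g (b * d) := fun g => Subgroup.mem_center_iff.1 hc g
  -- With bd central, b and d have the same centralizer; equal coprime lengths are 1.
  have h1 : classLength b = classLength d := by
    apply Nat.dvd_antisymm
    · refine classLength_dvd_of_le fun g hg => ?_
      have : b = (b * d) * d⁻¹ := by group
      rw [this]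
      exact (hcomm g).mul_right hg.inv_right
    · refine classLength_dvd_of_le fun g hg => ?_
      have : d = b⁻¹ * (b * d) := by group
      rw [this]
      exact hg.inv_right.mul_right (hcomm g)
  rw [← classLength_eq_one_iff]
  exact Nat.eq_one_of_dvd_coprimes (S.coprime b hb d hd) dvd_rfl (h1 ▸ dvd_rfl)

/-- The map y ↦ d y b⁻¹ embeds the class of b into the class of d, which absorbs the quotients y
b⁻¹. -/
theorem classLength_le_of_mul_mem_right (S : ClassSplit p U V) {b d : G} (hb : b ∈ U) (hd : d ∈ V)
    (hbd : b * d ∈ V) : classLength b ≤ classLength d := by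
  rw [← card_carrier_eq_classLength, ← card_carrier_eq_classLength]
  have key : ∀ b', IsConj b b' → IsConj d (d * (b' * b⁻¹)) := fun b' h' =>
    (S.mem_classStabilizer_right hb hd hbd h' (IsConj.refl b) d).2 (IsConj.refl d)
  have mem : ∀ x y : G, y ∈ (ConjClasses.mk x).carrier ↔ IsConj x y := fun x y => by
    rw [ConjClasses.mem_carrier_iff_mk_eq, ConjClasses.mk_eq_mk_iff_isConj, isConj_comm]
  refine Nat.card_le_card_of_injective
    (fun y : (ConjClasses.mk b).carrier => (⟨d * (y * b⁻¹), (mem _ _).2 (key _ ((mem _ _).1 y.2))⟩ :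
      (ConjClasses.mk d).carrier)) fun y z h => ?_
  simpa [Subtype.ext_iff] using h

end ClassSplit

end Split

/-! ### Construction of the abelian normal subgroup N. -/

section Kernel

variable {G : Type*} [Group G]

/-- An abelian normal subgroup `N` of the `p`-complement `H` that contains the elements of `H` in `V`
and no element of `U`, and whose commutator subgroup `[G, N]` stabilizes the classes in `U`. -/
structure SplitKernel (p : ℕ) (H N : Subgroup G) (U V : Set G) : Prop where
  split : ClassSplit p U V
  compl : IsPComplement p H
  normal : N.Normal
  le : N ≤ H
  comm : ∀ x ∈ N, ∀ y ∈ N, Commute x y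
  disj : ∀ x ∈ N, x ∉ U
  right_mem : ∀ x ∈ H, x ∈ V → x ∈ N
  center_mem : ∀ x ∈ H, x ∈ Subgroup.center G → x ∈ N
  exists_right : ∃ x ∈ N, x ∈ V
  exists_left : ∃ x ∈ H, x ∈ U
  absorb : ∀ b ∈ H, b ∈ U → ⁅(⊤ : Subgroup G), N⁆ ≤ classStabilizer b

theorem commutator_top_mem {N : Subgroup G} {n : G} (hn : n ∈ N) (g : G) :
    g * n * g⁻¹ * n⁻¹ ∈ ⁅(⊤ : Subgroup G), N⁆ :=
  Subgroup.commutator_mem_commutator (Subgroup.mem_top g) hn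

/-- Because M centralizes N, k ↦ [k, x] is a homomorphism from N to M with kernel C_N(x). The index
of this kernel divides both |M| and the length of x. -/
theorem commute_of_coprime_classLength [Finite G] {N M : Subgroup G} [N.Normal] {x : G}
    (hx : x ∈ N) (hM : ∀ g, g * x * g⁻¹ * x⁻¹ ∈ M) (hMN : ∀ m ∈ M, ∀ n ∈ N, Commute m n)
    (hc : (Nat.card M).Coprime (classLength x)) : ∀ n ∈ N, Commute n x := by
  let f : N →* G :=
    { toFun := fun k => k * x * (k : G)⁻¹ * x⁻¹
      map_one' := by simp
      map_mul' := by
        intro k l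
        have h1 : Commute ((l : G) * x * (l : G)⁻¹ * x⁻¹) k := hMN _ (hM _) _ k.2
        have h2 : Commute ((l : G) * x * (l : G)⁻¹ * x⁻¹) ((k : G) * x * (k : G)⁻¹ * x⁻¹) :=
          hMN _ (hM _) _ (N.mul_mem (N.mul_mem (N.mul_mem k.2 hx) (N.inv_mem k.2)) (N.inv_mem hx))
        rw [← h2.eq]
        calc ((k * l : N) : G) * x * ((k * l : N) : G)⁻¹ * x⁻¹
            = k * ((l : G) * x * (l : G)⁻¹ * x⁻¹) * x * (k : G)⁻¹ * x⁻¹ := by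
              push_cast; group
          _ = _ := by rw [← h1.eq]; group }
  have hker : f.ker = (Subgroup.centralizer ({x} : Set G)).subgroupOf N := by
    ext k
    rw [MonoidHom.mem_ker, Subgroup.mem_subgroupOf, mem_centralizer_singleton]
    change (k : G) * x * (k : G)⁻¹ * x⁻¹ = 1 ↔ (k : G) * x = x * k
    rw [mul_inv_eq_one, mul_inv_eq_iff_eq_mul]
  have h1 : (Subgroup.centralizer ({x} : Set G)).relIndex N ∣ Nat.card M := by
    rw [Subgroup.relIndex, ← hker, Subgroup.index_ker]
    refine Subgroup.card_dvd_of_le ?_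
    rintro _ ⟨k, rfl⟩
    exact hM k
  have h2 : (Subgroup.centralizer ({x} : Set G)).relIndex N ∣ classLength x :=
    relIndex_dvd_index_of_right_normal _ _
  have h3 := Subgroup.relIndex_eq_one.1 (Nat.eq_one_of_dvd_coprimes hc h1 h2)
  exact fun n hn => mem_centralizer_singleton.1 (h3 hn)

theorem not_dvd_orderOf_mul {p : ℕ} (hp : p.Prime) {x y : G} (h : Commute x y)
    (hx : ¬ p ∣ orderOf x) (hy : ¬ p ∣ orderOf y) : ¬ p ∣ orderOf (x * y) := fun hd => by
  have h1 := hd.trans (h.orderOf_mul_dvd_mul_orderOf)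
  rcases hp.dvd_mul.1 h1 with h | h
  exacts [hx h, hy h]

variable [Finite G]

/-- The maximal element b₀ makes |M| coprime to the lengths in V. Hence M centralizes the generators
of N, and then so does N itself. Being abelian and generated by p-regular elements, N is a normal
p'-subgroup, so it lies in H. -/
theorem ClassSplit.splitKernel {p : ℕ} (hp : p.Prime) {H : Subgroup G} (hH : IsPComplement p H)
    {U V : Set G} (S : ClassSplit p U V) {b₀ : G} (hb₀ : b₀ ∈ U) (hb₀H : b₀ ∈ H)
    (hmax : ∀ x ∈ H, x ∈ V → classLength x ≤ classLength b₀) :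
    ∃ N, SplitKernel p H N U V := by
  have regH : ∀ x ∈ H, ¬ p ∣ orderOf x := fun x hx => not_dvd_orderOf_of_mem hp hH.1 hx
  set A : Set G := {x | x ∈ H ∧ (x ∈ V ∨ x ∈ Subgroup.center G)} with hA
  set N := Subgroup.normalClosure A with hN
  have hAN : ∀ x ∈ A, x ∈ N := fun x hx => Subgroup.subset_normalClosure hx
  -- the commutator subgroup stabilizes the class of an element all of whose products stay in `U`
  have stab : ∀ b ∈ U, (∀ d ∈ H, d ∈ V → b * d ∈ U) → ⁅(⊤ : Subgroup G), N⁆ ≤ classStabilizer b := by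
    intro b hb h
    refine commutator_top_normalClosure_le fun s hs g => ?_
    rcases hs.2 with hsV | hsc
    · exact S.mem_classStabilizer hb hsV (h s hs.1 hsV) (isConj_conj g s) (IsConj.refl s)
    · have : g * s * g⁻¹ * s⁻¹ = 1 := by rw [Subgroup.mem_center_iff.1 hsc g]; group
      rw [this]; exact Subgroup.one_mem _
  have hM₀ : ⁅(⊤ : Subgroup G), N⁆ ≤ classStabilizer b₀ := by
    refine stab b₀ hb₀ fun d hdH hd => (S.mul_mem_or hb₀ hd (regH _ (H.mul_mem hb₀H hdH))).resolve_right
      fun hV => S.noncentral_left b₀ hb₀ ?_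
    -- If b₀d were in V, b₀ and d would have equal, hence trivial, class lengths.
    have h1 := le_antisymm (S.classLength_le_of_mul_mem_right hb₀ hd hV) (hmax d hdH hd)
    rw [← classLength_eq_one_iff]
    exact Nat.eq_one_of_dvd_coprimes (S.coprime b₀ hb₀ d hd) dvd_rfl (h1 ▸ dvd_rfl)
  set M := ⁅(⊤ : Subgroup G), N⁆ with hM
  have hMcard : Nat.card M ∣ classLength b₀ := card_dvd_classLength_of_le hM₀
  have hMcop : ∀ x ∈ V, (Nat.card M).Coprime (classLength x) := fun x hx =>
    (S.coprime b₀ hb₀ x hx).coprime_dvd_left hMcard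
  have hMA : ∀ x ∈ A, ∀ m ∈ M, Commute m x := by
    intro x hx
    rcases hx.2 with hxV | hxc
    · exact le_centralizer_of_coprime (hMcop x hxV)
    · exact fun m _ => Subgroup.mem_center_iff.1 hxc m
  have hMN : ∀ m ∈ M, ∀ n ∈ N, Commute m n := by
    have h1 : N ≤ Subgroup.centralizer (M : Set G) :=
      Subgroup.normalClosure_le_normal fun x hx =>
        Subgroup.mem_centralizer_iff.2 fun m hm => hMA x hx m hm
    exact fun m hm n hn => Subgroup.mem_centralizer_iff.1 (h1 hn) m hm
  have hNA : ∀ x ∈ A, ∀ n ∈ N, Commute n x := by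
    intro x hx
    rcases hx.2 with hxV | hxc
    · exact commute_of_coprime_classLength (hAN x hx) (commutator_top_mem (hAN x hx)) hMN
        (hMcop x hxV)
    · exact fun m _ => Subgroup.mem_center_iff.1 hxc m
  have hcomm : ∀ x ∈ N, ∀ y ∈ N, Commute x y := by
    have h1 : N ≤ Subgroup.centralizer (N : Set G) :=
      Subgroup.normalClosure_le_normal fun x hx =>
        Subgroup.mem_centralizer_iff.2 fun m hm => hNA x hx m hm
    exact fun m hm n hn => Subgroup.mem_centralizer_iff.1 (h1 hn) m hm
  have hreg : ∀ x ∈ N, ¬ p ∣ orderOf x := by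
    intro x hx
    refine Subgroup.closure_induction (p := fun x _ => ¬ p ∣ orderOf x) ?_ ?_ ?_ ?_ hx
    · intro y hy
      obtain ⟨a, ha, hay⟩ := Group.mem_conjugatesOfSet_iff.1 hy
      rw [← orderOf_eq_of_isConj hay]
      exact regH a ha.1
    · rw [orderOf_one]; exact hp.one_lt.ne' ∘ Nat.dvd_one.1
    · exact fun x y hx hy h1 h2 => not_dvd_orderOf_mul hp (hcomm x hx y hy) h1 h2
    · exact fun x _ h => by rwa [orderOf_inv]
  have hNH : N ≤ H := hH.le_of_normal hp hreg
  -- If bd ∈ V, each [g, b] stabilizes the class of d and also lies in M. Its order divides two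
  -- coprime numbers, so b would be central.
  have hNU : ∀ b ∈ N, b ∈ U → ∀ d ∈ H, d ∈ V → b * d ∈ U := by
    intro b hbN hb d hdH hd
    refine (S.mul_mem_or hb hd (regH _ (H.mul_mem (hNH hbN) hdH))).resolve_right
      fun hV => S.noncentral_left b hb ?_
    rw [Subgroup.mem_center_iff]
    intro g
    have h1 := S.mem_classStabilizer_right hb hd hV (isConj_conj g b) (IsConj.refl b)
    have h2 : Nat.card (Subgroup.zpowers (g * b * g⁻¹ * b⁻¹)) ∣ classLength d :=
      card_dvd_classLength_of_le (Subgroup.zpowers_le.2 h1)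
    have h3 : Nat.card (Subgroup.zpowers (g * b * g⁻¹ * b⁻¹)) ∣ Nat.card M :=
      Subgroup.card_dvd_of_le (Subgroup.zpowers_le.2 (commutator_top_mem hbN g))
    have h4 := Nat.eq_one_of_dvd_coprimes (hMcop d hd) h3 h2
    rw [Subgroup.card_eq_one, Subgroup.zpowers_eq_bot, mul_inv_eq_one, mul_inv_eq_iff_eq_mul] at h4
    exact h4
  have hdisj : ∀ x ∈ N, x ∉ U := by
    intro b hbN hb
    have key : ∀ n ∈ N, ∀ b ∈ N, b ∈ U → b * n ∈ U := by
      intro n hn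
      refine Subgroup.closure_induction
        (p := fun n _ => ∀ b ∈ N, b ∈ U → b * n ∈ U) ?_ (by simp) ?_ ?_ hn
      · intro y hy b hbN hb
        obtain ⟨a, ha, hay⟩ := Group.mem_conjugatesOfSet_iff.1 hy
        have hyN : y ∈ N := Subgroup.conjugatesOfSet_subset_normalClosure hy
        rcases ha.2 with haV | hac
        · exact hNU b hbN hb y (hNH hyN) (S.symm.mem_left_of_isConj haV hay)
        · have hyc := (mem_center_iff_of_isConj hay).1 hac
          have hbyc : b * y ∉ Subgroup.center G := fun h =>
            S.noncentral_left b hb (by simpa using mul_mem h (inv_mem hyc))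
          refine S.mem_left_of_dvd hb (hreg _ (N.mul_mem hbN hyN)) hbyc ?_
          exact classLength_dvd_of_le fun g hg => hg.mul_right (Subgroup.mem_center_iff.1 hyc g)
      · intro x y hx hy h1 h2 b hbN hb
        rw [← mul_assoc]
        exact h2 _ (N.mul_mem hbN hx) (h1 b hbN hb)
      · intro x hx h b hbN hb
        have hk : ∀ k : ℕ, b * x ^ k ∈ U := by
          intro k
          induction k with
          | zero => simpa using hb
          | succ k ih =>
            rw [pow_succ, ← mul_assoc]
            exact h _ (N.mul_mem hbN (N.pow_mem hx k)) ih
        have := hk (orderOf x - 1)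
        rwa [← mul_one (x ^ _), ← mul_inv_cancel x, ← mul_assoc (x ^ _), ← pow_succ,
          Nat.sub_add_cancel (orderOf_pos x), pow_orderOf_eq_one, one_mul] at this
    -- `N ∩ U` is closed under right multiplication by N, so it would contain b b⁻¹ = 1, which is
    -- central.
    have h1 := key b⁻¹ (N.inv_mem hbN) b hbN hb
    rw [mul_inv_cancel] at h1
    exact S.noncentral_left 1 h1 (Subgroup.one_mem _)
  obtain ⟨v, hv, hvH⟩ := S.symm.exists_primary_left hp hH
  refine ⟨N, S, hH, Subgroup.normalClosure_normal, hNH, hcomm, hdisj,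
    fun x hx hxV => hAN x ⟨hx, Or.inl hxV⟩, fun x hx hxc => hAN x ⟨hx, Or.inr hxc⟩,
    ⟨v, hAN v ⟨hvH, Or.inl hv⟩, hv⟩, ⟨b₀, hb₀H, hb₀⟩, fun b hbH hb => stab b hb fun d hdH hd => ?_⟩
  refine (S.mul_mem_or hb hd (regH _ (H.mul_mem hbH hdH))).resolve_right fun hV => ?_
  -- If bd ∈ V, then bd and d both lie in N, and so does b, against disjointness from U.
  have h1 := N.mul_mem (hAN _ ⟨H.mul_mem hbH hdH, Or.inl hV⟩) (N.inv_mem (hAN d ⟨hdH, Or.inl hd⟩))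
  rw [mul_inv_cancel_right] at h1
  exact hdisj b h1 hb

theorem ClassSplit.exists_splitKernel {p : ℕ} (hp : p.Prime) {H : Subgroup G}
    (hH : IsPComplement p H) {U V : Set G} (S : ClassSplit p U V) :
    ∃ N, SplitKernel p H N U V ∨ SplitKernel p H N V U := by
  obtain ⟨u, huU, huH⟩ := S.exists_primary_left hp hH
  obtain ⟨b, ⟨hbH, hb⟩, hmax⟩ := Set.exists_max_image {x | x ∈ H ∧ (x ∈ U ∨ x ∈ V)} classLength
    (Set.toFinite _) ⟨u, huH, Or.inl huU⟩
  rcases hb with hb | hb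
  · obtain ⟨N, hN⟩ := S.splitKernel hp hH hb hbH fun x hx hxV => hmax x ⟨hx, Or.inr hxV⟩
    exact ⟨N, Or.inl hN⟩
  · obtain ⟨N, hN⟩ := S.symm.splitKernel hp hH hb hbH fun x hx hxV => hmax x ⟨hx, Or.inl hxV⟩
    exact ⟨N, Or.inr hN⟩

end Kernel

/-! ### The primes q and r attached to N and to H/N. -/

section Primes

variable {G : Type*} [Group G]

theorem exists_pow_mul_eq_right {a b : ℕ} (h : a.Coprime b) :
    ∃ n : ℕ, ∀ x y : G, Commute x y → x ^ a = 1 → y ^ b = 1 → (x * y) ^ n = y := by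
  obtain ⟨n, hn1, hn2⟩ := Nat.chineseRemainder h 0 1
  refine ⟨n, fun x y hxy hx hy => ?_⟩
  have h1 : x ^ n = 1 := orderOf_dvd_iff_pow_eq_one.1
    ((orderOf_dvd_of_pow_eq_one hx).trans (Nat.modEq_zero_iff_dvd.1 hn1))
  have h2 : y ^ n = y ^ 1 := pow_eq_pow_iff_modEq.2 (hn2.of_dvd (orderOf_dvd_of_pow_eq_one hy))
  rw [hxy.mul_pow, h1, h2, one_mul, pow_one]

theorem coprime_prime_pow {r s : ℕ} (hr : r.Prime) (hs : s.Prime) (h : r ≠ s) (a b : ℕ) :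
    (r ^ a).Coprime (s ^ b) := Nat.Coprime.pow _ _ ((Nat.coprime_primes hr hs).2 h)

theorem pow_order_pow {x : G} {n : ℕ} (h : orderOf x = n) : x ^ n = 1 := h ▸ pow_orderOf_eq_one x

theorem mem_of_orderOf_eq_pow_zero {x : G} {n : ℕ} (h : orderOf x = n ^ 0) (K : Subgroup G) :
    x ∈ K := by
  rw [orderOf_eq_one_iff.1 (h.trans (pow_zero n))]; exact K.one_mem

theorem exists_orderOf_eq_of_pow {x : G} {r k : ℕ} (hr : r.Prime) (h : x ^ r ^ k = 1) :
    ∃ l, orderOf x = r ^ l := by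
  obtain ⟨l, -, hl⟩ := (Nat.dvd_prime_pow hr).1 (orderOf_dvd_of_pow_eq_one h)
  exact ⟨l, hl⟩

theorem mem_of_pow_mem_of_not_dvd {K : Subgroup G} {x : G} {r k : ℕ} (hr : r.Prime)
    (h : x ^ r ^ k ∈ K) (hx : ¬ r ∣ orderOf x) : x ∈ K := by
  have hc : (r ^ k).Coprime (orderOf x) := (hr.coprime_iff_not_dvd.2 hx).pow_left k
  obtain ⟨n, hn1, hn2⟩ := Nat.chineseRemainder hc 0 1
  obtain ⟨m, rfl⟩ := Nat.modEq_zero_iff_dvd.1 hn1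
  have h2 : x ^ (r ^ k * m) = x ^ 1 := pow_eq_pow_iff_modEq.2 hn2
  rw [← pow_one x, ← h2, pow_mul]
  exact K.pow_mem h m

variable [Finite G]

/-- In the abelian case, y outside ⟨x⟩ makes x, y, xy distinct. If G/Z(G) is not cyclic, take z ≠ 1
central, w with non-trivial central image w̄ in G/Z(G), and u with image outside ⟨w̄⟩: no two of
them are conjugate. -/
theorem isCyclic_of_three_isConj {q : ℕ} [Fact q.Prime] (hG : IsPGroup q G)
    (h : ∀ x y z : G, x ≠ 1 → y ≠ 1 → z ≠ 1 → IsConj x y ∨ IsConj x z ∨ IsConj y z) :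
    IsCyclic G := by
  by_cases hcyc : IsCyclic (G ⧸ Subgroup.center G)
  · have hcomm := (QuotientGroup.mk' (Subgroup.center G)).isMulCommutative_of_isCyclic_of_ker_le_center
      (by rw [QuotientGroup.ker_mk'])
    have hc : ∀ a b : G, a * b = b * a := fun a b => hcomm.is_comm.comm a b
    have heq : ∀ a b : G, IsConj a b → a = b := fun a b hab => by
      obtain ⟨g, rfl⟩ := isConj_iff.1 hab
      rw [hc g a, mul_inv_cancel_right]
    by_cases ht : ∃ x : G, x ≠ 1
    · obtain ⟨x, hx⟩ := ht
      refine isCyclic_iff_exists_zpowers_eq_top.2 ⟨x, (Subgroup.eq_top_iff' _).2 fun y => ?_⟩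
      by_contra hy
      have hy1 : y ≠ 1 := fun h => hy (h ▸ Subgroup.one_mem _)
      have hxy : x * y ≠ 1 := fun h => hy (by
        rw [eq_inv_of_mul_eq_one_right h]; exact inv_mem (Subgroup.mem_zpowers x))
      rcases h x y (x * y) hx hy1 hxy with h | h | h
      · exact hy (heq _ _ h ▸ Subgroup.mem_zpowers x)
      · exact hy1 (by simpa using heq _ _ h)
      · exact hx (by simpa using heq _ _ h)
    · push Not at ht
      have : Subsingleton G := ⟨fun x y => (ht x).trans (ht y).symm⟩
      infer_instance
  · exfalso
    have hnt : Nontrivial (G ⧸ Subgroup.center G) := by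
      by_contra hn
      rw [not_nontrivial_iff_subsingleton] at hn
      exact hcyc inferInstance
    have hnt' : Nontrivial G := by
      by_contra hn
      rw [not_nontrivial_iff_subsingleton] at hn
      exact not_subsingleton (G ⧸ Subgroup.center G) inferInstance
    have h1 := hG.center_nontrivial
    have h2 := (hG.to_quotient (Subgroup.center G)).center_nontrivial
    obtain ⟨⟨z, hz⟩, hz1⟩ := exists_ne (1 : Subgroup.center G)
    obtain ⟨⟨w', hw⟩, hw1⟩ := exists_ne (1 : Subgroup.center (G ⧸ Subgroup.center G))
    obtain ⟨u', hu⟩ : ∃ u', u' ∉ Subgroup.zpowers w' := by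
      by_contra hn
      push Not at hn
      exact hcyc ⟨w', hn⟩
    obtain ⟨w, rfl⟩ := QuotientGroup.mk_surjective w'
    obtain ⟨u, rfl⟩ := QuotientGroup.mk_surjective u'
    have hz1 : z ≠ 1 := fun h => hz1 (Subtype.ext h)
    have hwc : w ∉ Subgroup.center G := fun h => hw1 (Subtype.ext ((QuotientGroup.eq_one_iff w).2 h))
    have huc : u ∉ Subgroup.center G := fun h => hu (by
      rw [(QuotientGroup.eq_one_iff u).2 h]; exact Subgroup.one_mem _)
    rcases h z w u hz1 (fun h => hwc (h ▸ Subgroup.one_mem _)) (fun h => huc (h ▸ Subgroup.one_mem _))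
      with h | h | h
    · exact hwc ((mem_center_iff_of_isConj h).1 hz)
    · exact huc ((mem_center_iff_of_isConj h).1 hz)
    · obtain ⟨g, rfl⟩ := isConj_iff.1 h
      refine hu ?_
      have := Subgroup.mem_center_iff.1 hw g
      rw [QuotientGroup.mk_mul, QuotientGroup.mk_mul, QuotientGroup.mk_inv, this,
        mul_inv_cancel_right]
      exact Subgroup.mem_zpowers _

namespace SplitKernel

variable {p : ℕ} {H N : Subgroup G} {U V : Set G}

omit [Finite G] in
theorem regular (K : SplitKernel p H N U V) (hp : p.Prime) {x : G} (hx : x ∈ H) :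
    ¬ p ∣ orderOf x := not_dvd_orderOf_of_mem hp K.compl.1 hx

omit [Finite G] in
theorem mem_left (K : SplitKernel p H N U V) (hp : p.Prime) {x : G} (hx : x ∈ H) (hxN : x ∉ N) :
    x ∈ U :=
  (K.split.cover x (K.regular hp hx) fun h => hxN (K.center_mem x hx h)).resolve_right
    fun h => hxN (K.right_mem x hx h)

omit [Finite G] in
theorem mem_right (K : SplitKernel p H N U V) (hp : p.Prime) {x : G} (hx : x ∈ N)
    (hxc : x ∉ Subgroup.center G) : x ∈ V :=
  (K.split.cover x (K.regular hp (K.le hx)) hxc).resolve_left (K.disj x hx)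

omit [Finite G] in
theorem commutator_le (K : SplitKernel p H N U V) : ⁅(⊤ : Subgroup G), N⁆ ≤ N :=
  have := K.normal
  Subgroup.commutator_le_right _ _

omit [Finite G] in
theorem commutator_normal (K : SplitKernel p H N U V) : ⁅(⊤ : Subgroup G), N⁆.Normal :=
  have := K.normal
  inferInstance

omit [Finite G] in
theorem isConj_mul (K : SplitKernel p H N U V) (hp : p.Prime) {x m : G} (hx : x ∈ H) (hxN : x ∉ N)
    (hm : m ∈ ⁅(⊤ : Subgroup G), N⁆) : IsConj x (x * m) :=
  (K.absorb x hx (K.mem_left hp hx hxN) hm x).2 (IsConj.refl x)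

theorem coprime_card (K : SplitKernel p H N U V) {x : G} (hx : x ∈ V) :
    (Nat.card (⁅(⊤ : Subgroup G), N⁆ : Subgroup G)).Coprime (classLength x) := by
  obtain ⟨b, hbH, hb⟩ := K.exists_left
  exact (K.split.coprime b hb x hx).coprime_dvd_left (card_dvd_classLength_of_le (K.absorb b hbH hb))

omit [Finite G] in
theorem card_ne_one (K : SplitKernel p H N U V) : Nat.card (⁅(⊤ : Subgroup G), N⁆ : Subgroup G) ≠ 1 := by
  obtain ⟨v, hvN, hv⟩ := K.exists_right
  intro h
  rw [Subgroup.card_eq_one] at h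
  refine K.split.noncentral_right v hv (Subgroup.mem_center_iff.2 fun g => ?_)
  have := commutator_top_mem hvN g
  rwa [h, Subgroup.mem_bot, mul_inv_eq_one, mul_inv_eq_iff_eq_mul] at this

/-- Otherwise n ^ m is central for all n ∈ N, where m is the ℓ'-part of |N|. As N is abelian, [g, n]
^ m = 1, so [G, N] has exponent dividing m and no element of order ℓ. -/
theorem exists_noncentral_of_dvd (K : SplitKernel p H N U V) {ℓ : ℕ} (hℓ : ℓ.Prime)
    (hd : ℓ ∣ Nat.card (⁅(⊤ : Subgroup G), N⁆ : Subgroup G)) :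
    ∃ x ∈ N, x ∉ Subgroup.center G ∧ ∃ k, orderOf x = ℓ ^ k := by
  by_contra! hcon
  have hN := K.normal
  have := Fact.mk hℓ
  obtain ⟨a, m, hm, hn⟩ := Nat.exists_eq_pow_mul_and_not_dvd (Nat.card_pos (α := N)).ne' ℓ hℓ.ne_one
  have hpow : ∀ n ∈ N, n ^ m ∈ Subgroup.center G := by
    intro n hnN
    by_contra hc
    have h1 : (n ^ m) ^ ℓ ^ a = 1 := by
      rw [← pow_mul, mul_comm, ← hn]
      have := pow_card_eq_one' (x := (⟨n, hnN⟩ : N))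
      exact congrArg Subtype.val this
    obtain ⟨l, hl⟩ := exists_orderOf_eq_of_pow hℓ h1
    exact hcon _ (N.pow_mem hnN m) hc l hl
  let T : Subgroup G :=
    { carrier := {x | x ∈ N ∧ x ^ m = 1}
      one_mem' := ⟨N.one_mem, one_pow _⟩
      mul_mem' := fun {x y} hx hy => ⟨N.mul_mem hx.1 hy.1, by
        rw [(K.comm x hx.1 y hy.1).mul_pow, hx.2, hy.2, one_mul]⟩
      inv_mem' := fun {x} hx => ⟨N.inv_mem hx.1, by rw [inv_pow, hx.2, inv_one]⟩ }
  have hT : ⁅(⊤ : Subgroup G), N⁆ ≤ T := by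
    rw [Subgroup.commutator_le]
    intro g _ n hnN
    have hg : g * n * g⁻¹ ∈ N := hN.conj_mem n hnN g
    refine ⟨N.mul_mem hg (N.inv_mem hnN), ?_⟩
    rw [commutatorElement_def, (K.comm _ hg _ (N.inv_mem hnN)).mul_pow, conj_pow, inv_pow,
      Subgroup.mem_center_iff.1 (hpow n hnN) g, mul_inv_cancel_right, mul_inv_cancel]
  obtain ⟨x, hx⟩ := exists_prime_orderOf_dvd_card' ℓ hd
  have h1 := orderOf_dvd_of_pow_eq_one (hT x.2).2
  rw [Subgroup.orderOf_coe, hx] at h1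
  exact hm h1

/-- A non-central q-element x and a non-central q'-element y of N would give x, y, xy in V with
three different orders. -/
theorem exists_prime (K : SplitKernel p H N U V) (hp : p.Prime) :
    ∃ q : ℕ, q.Prime ∧ q ∣ Nat.card (⁅(⊤ : Subgroup G), N⁆ : Subgroup G) ∧
      ∀ x ∈ N, ¬ q ∣ orderOf x → x ∈ Subgroup.center G := by
  obtain ⟨q, hq, hd⟩ := Nat.exists_prime_and_dvd K.card_ne_one
  refine ⟨q, hq, hd, fun y hy hyq => ?_⟩
  by_contra hyc
  obtain ⟨x, hx, hxc, k, hk⟩ := K.exists_noncentral_of_dvd hq hd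
  have hxy := K.comm x hx y hy
  have hcop : (orderOf x).Coprime (orderOf y) := by
    rw [hk]; exact (hq.coprime_iff_not_dvd.2 hyq).pow_left k
  have hmul := hxy.orderOf_mul_eq_mul_orderOf_of_coprime hcop
  have hxyc : x * y ∉ Subgroup.center G := fun h => by
    obtain ⟨n, hn⟩ := exists_pow_mul_eq_right (G := G) hcop
    have := hn x y hxy (pow_orderOf_eq_one x) (pow_orderOf_eq_one y)
    exact hyc (this ▸ Subgroup.pow_mem _ h n)
  have hx1 : orderOf x ≠ 1 := fun h => hxc (by
    rw [orderOf_eq_one_iff.1 h]; exact Subgroup.one_mem _)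
  have hy1 : orderOf y ≠ 1 := fun h => hyc (by
    rw [orderOf_eq_one_iff.1 h]; exact Subgroup.one_mem _)
  rcases K.split.three_right x (K.mem_right hp hx hxc) y (K.mem_right hp hy hyc) (x * y)
    (K.mem_right hp (N.mul_mem hx hy) hxyc) with h | h | h
  · have h1 := orderOf_eq_of_isConj h
    rw [← h1, Nat.coprime_self] at hcop
    exact hx1 hcop
  · have h1 := orderOf_eq_of_isConj h
    rw [hmul] at h1
    exact hy1 (Nat.eq_of_mul_eq_mul_left (orderOf_pos x) (by rw [← h1, mul_one]))
  · have h1 := orderOf_eq_of_isConj h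
    rw [hmul] at h1
    exact hx1 (Nat.eq_of_mul_eq_mul_right (orderOf_pos y) (by rw [← h1, one_mul]))

/-- Two elements of `H` outside `N` of coprime prime power orders lead to a contradiction. -/
theorem false_of_two_primes (K : SplitKernel p H N U V) (hp : p.Prime) {q : ℕ} (hq : q.Prime)
    (hqN : ∀ x ∈ N, ¬ q ∣ orderOf x → x ∈ Subgroup.center G) {x y : G} (hx : x ∈ H) (hxN : x ∉ N)
    (hy : y ∈ H) (hyN : y ∉ N) {r s k l : ℕ} (hr : r.Prime) (hs : s.Prime) (hrs : r ≠ s)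
    (hrq : r ≠ q) (hxo : orderOf x = r ^ k) (hyo : orderOf y = s ^ l) : False := by
  have hN := K.normal
  have hxU := K.mem_left hp hx hxN
  have hyU := K.mem_left hp hy hyN
  have hk : k ≠ 0 := by
    rintro rfl
    exact hxN (mem_of_orderOf_eq_pow_zero hxo N)
  have hl : l ≠ 0 := by
    rintro rfl
    exact hyN (mem_of_orderOf_eq_pow_zero hyo N)
  -- x and y are not conjugate, so every element of U is conjugate to one of them; elements of mixed
  -- order are excluded from U.
  have hU : ∀ u ∈ U, ∃ t a : ℕ, t.Prime ∧ orderOf u = t ^ a := by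
    intro u hu
    rcases K.split.three_left u hu x hxU y hyU with h | h | h
    · exact ⟨r, k, hr, by rw [orderOf_eq_of_isConj h, hxo]⟩
    · exact ⟨s, l, hs, by rw [orderOf_eq_of_isConj h, hyo]⟩
    · have h1 := orderOf_eq_of_isConj h
      have h2 := coprime_prime_pow hr hs hrs k l
      rw [← hxo, ← hyo, ← h1, Nat.coprime_self, hxo] at h2
      exact absurd h2 (Nat.one_lt_pow hk hr.one_lt).ne'
  have hprod : ∀ {u v : G} {a b c d : ℕ}, a.Prime → c.Prime → a ≠ c → b ≠ 0 → d ≠ 0 →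
      orderOf u = a ^ b → orderOf v = c ^ d → Commute u v → u * v ∈ U → False := by
    intro u v a b c d ha hc hac hb hd hu hv huv hmem
    obtain ⟨t, e, ht, he⟩ := hU _ hmem
    rw [huv.orderOf_mul_eq_mul_orderOf_of_coprime
      (by rw [hu, hv]; exact coprime_prime_pow ha hc hac b d), hu, hv] at he
    have h1 : a ∣ t ^ e := he ▸ (dvd_pow_self a hb).mul_right _
    have h2 : c ∣ t ^ e := he ▸ (dvd_pow_self c hd).mul_left _
    exact hac (((Nat.prime_dvd_prime_iff_eq ha ht).1 (ha.dvd_of_dvd_pow h1)).trans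
      ((Nat.prime_dvd_prime_iff_eq hc ht).1 (hc.dvd_of_dvd_pow h2)).symm)
  obtain ⟨d, hdN, hd⟩ := K.exists_right
  -- Otherwise x commutes with a conjugate of d, and x times the non-trivial q-part of that
  -- conjugate has mixed order.
  have hrd : r ∣ classLength d := by
    by_contra hrd
    obtain ⟨g, hg⟩ := exists_conj_commute_of_not_dvd hr hrd hxo
    set d' := g⁻¹ * d * g with hd'
    have hd'N : d' ∈ N := by simpa using hN.conj_mem d hdN g⁻¹
    have hd'c : d' ∉ Subgroup.center G := fun h => K.split.noncentral_right d hd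
      ((mem_center_iff_of_isConj (isConj_iff.2 ⟨g⁻¹, by simp [d']⟩)).2 h)
    have hcomm : Commute x d' := by
      have h1 := hg.eq
      change x * (g⁻¹ * d * g) = (g⁻¹ * d * g) * x
      calc x * (g⁻¹ * d * g) = g⁻¹ * (g * x * g⁻¹ * d) * g := by group
        _ = g⁻¹ * (d * (g * x * g⁻¹)) * g := by rw [h1]
        _ = _ := by group
    obtain ⟨i, j, ⟨a, ha⟩, hj, hij⟩ := exists_pow_primary d' hq
    have hi : d' ^ i ∉ Subgroup.center G := fun h => hd'c (by
      rw [hij]; exact mul_mem h (hqN _ (N.pow_mem hd'N j) hj))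
    have ha0 : a ≠ 0 := by
      rintro rfl
      exact hi (mem_of_orderOf_eq_pow_zero ha _)
    have hmem : x * d' ^ i ∉ N := fun h => hxN
      (by simpa using N.mul_mem h (N.inv_mem (N.pow_mem hd'N i)))
    exact hprod hr hq hrq hk ha0 hxo ha (hcomm.pow_right i)
      (K.mem_left hp (H.mul_mem hx (H.pow_mem (K.le hd'N) i)) hmem)
  -- By coprimality with the length of d. A conjugate of x then commutes with y, and their product
  -- is again of mixed order.
  have hry : ¬ r ∣ classLength y := fun h =>
    Nat.not_coprime_of_dvd_of_dvd hr.one_lt h hrd (K.split.coprime y hyU d hd)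
  obtain ⟨g, hg⟩ := exists_conj_commute_of_not_dvd hr hry hxo
  set x' := g * x * g⁻¹ with hx'
  have hx'o : orderOf x' = r ^ k := by rw [← hxo]; exact (orderOf_eq_of_isConj (isConj_conj g x)).symm
  have hcop : (r ^ k).Coprime (s ^ l) := coprime_prime_pow hr hs hrs k l
  obtain ⟨n, hn⟩ := exists_pow_mul_eq_right (G := G) hcop
  have hpow := hn x' y hg (pow_order_pow hx'o) (pow_order_pow hyo)
  refine hprod hr hs hrs hk hl hx'o hyo hg (K.split.mem_left_of_dvd' hyU ?_ ?_ ?_)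
  · refine not_dvd_orderOf_mul hp hg ?_ (K.regular hp hy)
    rw [hx'o, ← hxo]; exact K.regular hp hx
  · exact fun h => K.split.noncentral_left y hyU (hpow ▸ Subgroup.pow_mem _ h n)
  · conv_lhs => rw [← hpow]
    exact classLength_pow_dvd _ _

theorem exists_index_prime (K : SplitKernel p H N U V) (hp : p.Prime) {q : ℕ} (hq : q.Prime)
    (hqN : ∀ x ∈ N, ¬ q ∣ orderOf x → x ∈ Subgroup.center G) :
    ∃ r : ℕ, r.Prime ∧ ∀ x ∈ H, ∃ k, x ^ r ^ k ∈ N := by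
  obtain ⟨u, huH, hu⟩ := K.exists_left
  have huN : u ∉ N := fun h => K.disj u h hu
  obtain ⟨n, r, k, hr, hk, hnN⟩ := exists_primary_not_mem u huN
  refine ⟨r, hr, fun x hx => ?_⟩
  obtain ⟨i, j, ⟨l, hl⟩, hj, hij⟩ := exists_pow_primary x hr
  have hjN : x ^ j ∈ N := by
    by_contra hjN
    obtain ⟨m, s, t, hs, ht, hmN⟩ := exists_primary_not_mem (x ^ j) hjN
    have hne : r ≠ s := by
      rintro rfl
      rcases t with _ | t
      · exact hmN (mem_of_orderOf_eq_pow_zero ht N)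
      · refine hj ((dvd_pow_self r t.succ_ne_zero).trans ?_)
        rw [← ht]; exact orderOf_pow_dvd m
    have hyH := H.pow_mem (H.pow_mem hx j) m
    -- `false_of_two_primes` needs its first prime to differ from q; since r ≠ s, one of the two
    -- orderings works.
    by_cases hrq : r = q
    · exact K.false_of_two_primes hp hq hqN hyH hmN (H.pow_mem huH n) hnN hs hr hne.symm
        (fun h => hne (hrq.trans h.symm)) ht hk
    · exact K.false_of_two_primes hp hq hqN (H.pow_mem huH n) hnN hyH hmN hr hs hne hrq hk ht
  refine ⟨l, ?_⟩
  conv => rw [hij]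
  rw [((Commute.refl x).pow_pow i j).mul_pow, pow_order_pow hl, one_mul]
  exact N.pow_mem hjN _

end SplitKernel

end Primes

/-! ### Distinctness of q and r, and the fixed-point-free action on N. -/

section PrimeKernel

variable {G : Type*} [Group G]

/-- A `SplitKernel` together with the prime `q` outside which `N` is central and the prime `r` for
which `H / N` is an `r`-group. -/
structure PrimeKernel (p q r : ℕ) (H N : Subgroup G) (U V : Set G) : Prop
    extends SplitKernel p H N U V where
  prime_p : p.Prime
  prime_q : q.Prime
  prime_r : r.Prime
  dvd_card : q ∣ Nat.card (⁅(⊤ : Subgroup G), N⁆ : Subgroup G)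
  central : ∀ x ∈ N, ¬ q ∣ orderOf x → x ∈ Subgroup.center G
  pow_mem : ∀ x ∈ H, ∃ k, x ^ r ^ k ∈ N

theorem SplitKernel.exists_primeKernel [Finite G] {p : ℕ} (hp : p.Prime) {H N : Subgroup G}
    {U V : Set G} (K : SplitKernel p H N U V) : ∃ q r, PrimeKernel p q r H N U V := by
  obtain ⟨q, hq, hd, hc⟩ := K.exists_prime hp
  obtain ⟨r, hr, hpow⟩ := K.exists_index_prime hp hq hc
  exact ⟨q, r, K, hp, hq, hr, hd, hc, hpow⟩

namespace PrimeKernel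

variable [Finite G] {p q r : ℕ} {H N : Subgroup G} {U V : Set G}

theorem not_dvd_classLength (K : PrimeKernel p q r H N U V) {x : G} (hx : x ∈ V) :
    ¬ q ∣ classLength x := fun h =>
  Nat.not_coprime_of_dvd_of_dvd K.prime_q.one_lt K.dvd_card h (K.coprime_card hx)

theorem isPGroup_commutator (K : PrimeKernel p q r H N U V) {m : G}
    (hm : m ∈ ⁅(⊤ : Subgroup G), N⁆) : ∃ k, orderOf m = q ^ k := by
  obtain ⟨i, j, hi, hj, hij⟩ := exists_pow_primary m K.prime_q
  have h1 : m ^ j = 1 := by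
    by_contra h1
    obtain ⟨ℓ, hℓ, hd⟩ := Nat.exists_prime_and_dvd (mt orderOf_eq_one_iff.1 h1)
    have hmj := Subgroup.pow_mem _ hm j
    obtain ⟨x, hx, hxc, k, hk⟩ := K.exists_noncentral_of_dvd hℓ
      (hd.trans (Subgroup.orderOf_dvd_natCard _ hmj))
    refine hxc (K.central x hx fun hqx => ?_)
    rw [hk] at hqx
    have h2 := (Nat.prime_dvd_prime_iff_eq K.prime_q hℓ).1 (K.prime_q.dvd_of_dvd_pow hqx)
    exact hj (h2 ▸ hd)
  rw [h1, mul_one] at hij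
  rwa [hij]

theorem relIndex_eq_pow (K : PrimeKernel p q r H N U V) : ∃ k, N.relIndex H = r ^ k := by
  have hN := K.normal
  have := Fact.mk K.prime_r
  have h1 : IsPGroup r (H ⧸ N.subgroupOf H) := by
    intro c
    obtain ⟨x, rfl⟩ := QuotientGroup.mk_surjective c
    obtain ⟨k, hk⟩ := K.pow_mem x x.2
    exact ⟨k, by
      rw [← QuotientGroup.mk_pow, QuotientGroup.eq_one_iff, Subgroup.mem_subgroupOf]; exact hk⟩
  obtain ⟨k, hk⟩ := IsPGroup.iff_card.1 h1
  exact ⟨k, hk⟩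

/-- If r = q, lengths in V are prime to r. This makes N central in H and H/N cyclic, so H is
abelian; as G-conjugation of elements of H outside N is realised inside H, such elements would be
central in G. -/
theorem prime_r_ne_prime_q (K : PrimeKernel p q r H N U V) : r ≠ q := by
  rintro rfl
  have hN := K.normal
  have := Fact.mk K.prime_q
  obtain ⟨a, ha⟩ := K.relIndex_eq_pow
  obtain ⟨c, hc⟩ := K.compl.2
  obtain ⟨d, hdN, hd⟩ := K.exists_right
  have hNd : ∀ x ∈ N, N ≤ Subgroup.centralizer ({x} : Set G) := fun x hx n hn =>
    mem_centralizer_singleton.2 (K.comm n hn x hx)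
  -- The length of d divides |G : N|, a power of r times a power of p, and is prime to r.
  have hpd : p ∣ classLength d := by
    have h1 : classLength d ∣ r ^ a * p ^ c := by
      rw [← ha, ← hc, Subgroup.relIndex_mul_index K.le]
      exact Subgroup.index_dvd_of_le (hNd d hdN)
    have h2 : (classLength d).Coprime (r ^ a) :=
      (Nat.Coprime.pow_left a (K.prime_q.coprime_iff_not_dvd.2 (K.not_dvd_classLength hd))).symm
    obtain ⟨e, -, he⟩ := (Nat.dvd_prime_pow K.prime_p).1 (h2.dvd_of_dvd_mul_left h1)
    rcases e with _ | e
    · exact absurd (classLength_eq_one_iff.1 (by simpa using he)) (K.split.noncentral_right d hd)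
    · rw [he]; exact dvd_pow_self _ e.succ_ne_zero
  -- The length of b is prime to p and the index of H is a power of p, so G = H C(b).
  have hfac : ∀ b ∈ H, b ∉ N → ∀ g : G, ∃ h ∈ H, g * b * g⁻¹ = h * b * h⁻¹ := by
    intro b hbH hbN g
    have hpb : ¬ p ∣ classLength b := fun h => Nat.not_coprime_of_dvd_of_dvd K.prime_p.one_lt h hpd
      (K.split.coprime b (K.mem_left K.prime_p hbH hbN) d hd)
    have hcop : H.index.Coprime (Subgroup.centralizer ({b} : Set G)).index := by
      rw [hc]; exact Nat.Coprime.pow_left _ (K.prime_p.coprime_iff_not_dvd.2 hpb)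
    obtain ⟨h, hh, z, hz, rfl⟩ := exists_mul_eq_of_coprime_index hcop g
    refine ⟨h, hh, ?_⟩
    rw [mem_centralizer_singleton] at hz
    calc h * z * b * (h * z)⁻¹ = h * (z * b) * z⁻¹ * h⁻¹ := by group
      _ = _ := by rw [hz.eq]; group
  have hH : H.Normal := by
    refine ⟨fun b hb g => ?_⟩
    by_cases hbN : b ∈ N
    · exact K.le (hN.conj_mem b hbN g)
    · obtain ⟨h, hh, e⟩ := hfac b hb hbN g
      rw [e]; exact H.mul_mem (H.mul_mem hh hb) (H.inv_mem hh)
  have hHN : ∀ x ∈ N, ∀ h ∈ H, Commute h x := by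
    intro x hx
    by_cases hxc : x ∈ Subgroup.center G
    · exact fun h _ => Subgroup.mem_center_iff.1 hxc h
    have hxV := K.mem_right K.prime_p hx hxc
    have h1 : (Subgroup.centralizer ({x} : Set G)).relIndex H ∣ classLength x :=
      relIndex_dvd_index_of_right_normal _ _
    have h2 : (Subgroup.centralizer ({x} : Set G)).relIndex H ∣ r ^ a :=
      ha ▸ Subgroup.relIndex_dvd_of_le_left _ (hNd x hx)
    have h3 : (r ^ a).Coprime (classLength x) :=
      Nat.Coprime.pow_left a (K.prime_q.coprime_iff_not_dvd.2 (K.not_dvd_classLength hxV))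
    have h4 := Subgroup.relIndex_eq_one.1 (Nat.eq_one_of_dvd_coprimes h3 h2 h1)
    exact fun h hh => mem_centralizer_singleton.1 (h4 hh)
  have hQ : IsPGroup r (H ⧸ N.subgroupOf H) := IsPGroup.of_card ha
  have hcyc : IsCyclic (H ⧸ N.subgroupOf H) := by
    refine isCyclic_of_three_isConj hQ fun x y z hx hy hz => ?_
    have key : ∀ u v : H, (u : G) ∉ N → IsConj (u : G) v →
        IsConj (u : H ⧸ N.subgroupOf H) v := by
      intro u v hu huv
      obtain ⟨g, hg⟩ := isConj_iff.1 huv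
      obtain ⟨h, hh, e⟩ := hfac u u.2 hu g
      refine isConj_iff.2 ⟨((⟨h, hh⟩ : H) : H ⧸ N.subgroupOf H), ?_⟩
      rw [← QuotientGroup.mk_mul, ← QuotientGroup.mk_inv, ← QuotientGroup.mk_mul]
      congr 1
      exact Subtype.ext (e.symm.trans hg)
    obtain ⟨x, rfl⟩ := QuotientGroup.mk_surjective x
    obtain ⟨y, rfl⟩ := QuotientGroup.mk_surjective y
    obtain ⟨z, rfl⟩ := QuotientGroup.mk_surjective z
    simp only [ne_eq, QuotientGroup.eq_one_iff, Subgroup.mem_subgroupOf] at hx hy hz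
    have hU : ∀ u : H, (u : G) ∉ N → (u : G) ∈ U := fun u hu => K.mem_left K.prime_p u.2 hu
    exact (K.split.three_left x (hU x hx) y (hU y hy) z (hU z hz)).imp (key x y hx)
      (Or.imp (key x z hx) (key y z hy))
  have hcomm := (QuotientGroup.mk' (N.subgroupOf H)).isMulCommutative_of_isCyclic_of_ker_le_center (by
    rw [QuotientGroup.ker_mk']
    intro n hn
    exact Subgroup.mem_center_iff.2 fun h => Subtype.ext (hHN n hn h h.2).eq)
  obtain ⟨b, hbH, hb⟩ := K.exists_left
  refine K.split.noncentral_left b hb (Subgroup.mem_center_iff.2 fun g => ?_)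
  obtain ⟨h, hh, e⟩ := hfac b hbH (fun h => K.disj b h hb) g
  have h1 : h * b = b * h := congrArg Subtype.val (hcomm.is_comm.comm (⟨h, hh⟩ : H) ⟨b, hbH⟩)
  rwa [h1, mul_inv_cancel_right, mul_inv_eq_iff_eq_mul] at e

omit [Finite G] in
theorem mem_of_not_dvd (K : PrimeKernel p q r H N U V) {x : G} (hx : x ∈ H)
    (hr : ¬ r ∣ orderOf x) : x ∈ N := by
  obtain ⟨k, hk⟩ := K.pow_mem x hx
  exact mem_of_pow_mem_of_not_dvd K.prime_r hk hr

/-- Suppose d is non-central. Since x is conjugate to xm for every m ∈ M, comparing orders gives d ∉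
M. It then turns out that M stabilizes the class of d, whose length is prime to |M|; hence M = 1,
which is impossible. -/
theorem mem_center_of_commute_of_orderOf (K : PrimeKernel p q r H N U V) {x d : G} (hx : x ∈ H)
    (hxN : x ∉ N) (hd : d ∈ N) {k l : ℕ} (hxo : orderOf x = r ^ k) (hdo : orderOf d = q ^ l)
    (hxd : Commute x d) : d ∈ Subgroup.center G := by
  by_contra hdc
  have hN := K.normal
  have := Fact.mk K.prime_q
  set M := ⁅(⊤ : Subgroup G), N⁆ with hM
  have hMn : M.Normal := K.commutator_normal
  have hord : ∀ {y : G} {e : ℕ}, orderOf y = q ^ e → Commute x y → orderOf (x * y) = r ^ k * q ^ e :=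
    fun {y e} hy h => by
      rw [h.orderOf_mul_eq_mul_orderOf_of_coprime, hxo, hy]
      rw [hxo, hy]
      exact coprime_prime_pow K.prime_r K.prime_q K.prime_r_ne_prime_q k e
  have hone : ∀ {y : G} {e : ℕ}, orderOf y = q ^ e → Commute x y → IsConj x (x * y) → y = 1 := by
    intro y e hy h hc
    have h1 := orderOf_eq_of_isConj hc
    rw [hord hy h, hxo] at h1
    rw [← orderOf_eq_one_iff, hy]
    exact Nat.eq_of_mul_eq_mul_left (pow_pos K.prime_r.pos k) (by rw [← h1, mul_one])
  have hd1 : d ≠ 1 := fun h => hdc (h ▸ Subgroup.one_mem _)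
  have hdM : d ∉ M := fun h => hd1 (hone hdo hxd (K.isConj_mul K.prime_p hx hxN h))
  have hxmul : ∀ n ∈ N, x * n ∈ U := fun n hn => K.mem_left K.prime_p (H.mul_mem hx (K.le hn))
    fun h => hxN (by simpa using N.mul_mem h (N.inv_mem hn))
  -- Compare x, xz, xd. Orders separate x from xd, and from xz unless z = 1; if xz and xd were
  -- conjugate, so would be their q-parts z and d.
  have hZ : ∀ z ∈ N, z ∈ Subgroup.center G → ∀ j, orderOf z = q ^ j → z = 1 := by
    intro z hzN hzc j hzj
    have hxz : Commute x z := Subgroup.mem_center_iff.1 hzc x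
    rcases K.split.three_left x (K.mem_left K.prime_p hx hxN) _ (hxmul z hzN) _ (hxmul d hd)
      with h | h | h
    · exact hone hzj hxz h
    · exact absurd (hone hdo hxd h) hd1
    · exfalso
      obtain ⟨n, hn⟩ := exists_pow_mul_eq_right (G := G)
        (coprime_prime_pow K.prime_r K.prime_q K.prime_r_ne_prime_q k (max j l))
      have e1 := hn x z hxz (pow_order_pow hxo)
        (orderOf_dvd_iff_pow_eq_one.1 (hzj ▸ pow_dvd_pow q (le_max_left j l)))
      have e2 := hn x d hxd (pow_order_pow hxo)
        (orderOf_dvd_iff_pow_eq_one.1 (hdo ▸ pow_dvd_pow q (le_max_right j l)))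
      obtain ⟨g, hg⟩ := isConj_iff.1 h
      rw [← hg, conj_pow, e1] at e2
      exact hdc ((mem_center_iff_of_isConj (isConj_iff.2 ⟨g, e2⟩)).1 hzc)
  obtain ⟨⟨m, hm⟩, hmo⟩ := exists_prime_orderOf_dvd_card' q K.dvd_card
  rw [Subgroup.orderOf_mk] at hmo
  have hmN := K.commutator_le hm
  have hmc : m ∉ Subgroup.center G := fun h => by
    rw [hZ m hmN h 1 (by rw [hmo, pow_one]), orderOf_one] at hmo
    exact K.prime_q.one_lt.ne hmo
  have hnot : ∀ y, y ∉ M → ¬ IsConj y m := fun y hy h => by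
    obtain ⟨g, rfl⟩ := isConj_iff.1 h.symm
    exact hy (hMn.conj_mem m hm g)
  -- Compare d, dm', m in V: only m lies in the normal subgroup M, so d and dm' are conjugate.
  have hstab : M ≤ classStabilizer d := by
    have hdm : ∀ m' ∈ M, IsConj d (d * m') := by
      intro m' hm'
      have hm'N := K.commutator_le hm'
      have hdm'M : d * m' ∉ M := fun h => hdM (by simpa using M.mul_mem h (M.inv_mem hm'))
      have hdm'c : d * m' ∉ Subgroup.center G := by
        intro h
        obtain ⟨e, he⟩ := K.isPGroup_commutator hm'
        have h1 : (d * m') ^ q ^ (l + e) = 1 := by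
          rw [(K.comm d hd m' hm'N).mul_pow, pow_add]
          conv_lhs => rw [pow_mul, pow_order_pow hdo, one_pow, one_mul, mul_comm, pow_mul,
            pow_order_pow he, one_pow]
        obtain ⟨f, hf⟩ := exists_orderOf_eq_of_pow K.prime_q h1
        exact hdm'M (hZ _ (N.mul_mem hd hm'N) h f hf ▸ M.one_mem)
      rcases K.split.three_right d (K.mem_right K.prime_p hd hdc) (d * m')
        (K.mem_right K.prime_p (N.mul_mem hd hm'N) hdm'c) m (K.mem_right K.prime_p hmN hmc)
        with h | h | h
      · exact h
      · exact absurd h (hnot _ hdM)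
      · exact absurd h (hnot _ hdm'M)
    intro m' hm'
    refine mem_classStabilizer_of_forall fun y hy => ?_
    obtain ⟨g, rfl⟩ := isConj_iff.1 hy
    have h1 := (isConj_conj_iff g d _).2 (hdm (g⁻¹ * m' * g) (by simpa using hMn.conj_mem m' hm' g⁻¹))
    simpa [mul_assoc] using h1
  exact K.card_ne_one (Nat.eq_one_of_dvd_coprimes (K.coprime_card (K.mem_right K.prime_p hd hdc))
    dvd_rfl (card_dvd_classLength_of_le hstab))

theorem exists_primary_not_mem (K : PrimeKernel p q r H N U V) {x : G} (hx : x ∈ H) (hxN : x ∉ N) :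
    ∃ n k, orderOf (x ^ n) = r ^ k ∧ x ^ n ∉ N := by
  obtain ⟨i, j, ⟨k, hk⟩, hj, hij⟩ := exists_pow_primary x K.prime_r
  refine ⟨i, k, hk, fun h => hxN ?_⟩
  rw [hij]
  exact N.mul_mem h (K.mem_of_not_dvd (H.pow_mem hx j) hj)

theorem mem_center_of_commute (K : PrimeKernel p q r H N U V) {x n : G} (hx : x ∈ H)
    (hxN : x ∉ N) (hn : n ∈ N) (hxn : Commute x n) : n ∈ Subgroup.center G := by
  obtain ⟨a, k, hk, ha⟩ := K.exists_primary_not_mem hx hxN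
  obtain ⟨i, j, ⟨l, hl⟩, hj, hij⟩ := exists_pow_primary n K.prime_q
  rw [hij]
  exact mul_mem (K.mem_center_of_commute_of_orderOf (H.pow_mem hx a) ha (N.pow_mem hn i) hk hl
    (hxn.pow_pow a i)) (K.central _ (N.pow_mem hn j) hj)

/-- For an r-element x of H outside N, x and xm are conjugate, while a central q-element m
multiplies the order of x by its own. -/
theorem commutator_inf_center (K : PrimeKernel p q r H N U V) {m : G}
    (hm : m ∈ ⁅(⊤ : Subgroup G), N⁆) (hmc : m ∈ Subgroup.center G) : m = 1 := by
  obtain ⟨b, hbH, hb⟩ := K.exists_left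
  obtain ⟨a, k, hk, ha⟩ := K.exists_primary_not_mem hbH (fun h => K.disj b h hb)
  obtain ⟨e, he⟩ := K.isPGroup_commutator hm
  have h1 := orderOf_eq_of_isConj (K.isConj_mul K.prime_p (H.pow_mem hbH a) ha hm)
  have h2 : Commute (b ^ a) m := Subgroup.mem_center_iff.1 hmc _
  rw [h2.orderOf_mul_eq_mul_orderOf_of_coprime (by
    rw [hk, he]
    exact coprime_prime_pow K.prime_r K.prime_q K.prime_r_ne_prime_q k e)] at h1
  rw [← orderOf_eq_one_iff]
  exact Nat.eq_of_mul_eq_mul_left (orderOf_pos (b ^ a)) (by rw [← h1, mul_one])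

theorem center_le_iff (K : PrimeKernel p q r H N U V) {z : G} (hz : z ∈ H) :
    (∀ h ∈ H, Commute h z) ↔ z ∈ Subgroup.center G := by
  refine ⟨fun h => ?_, fun h g _ => Subgroup.mem_center_iff.1 h g⟩
  by_cases hzN : z ∈ N
  · obtain ⟨b, hbH, hb⟩ := K.exists_left
    exact K.mem_center_of_commute hbH (fun h => K.disj b h hb) hzN (h b hbH)
  · obtain ⟨d, hdN, hd⟩ := K.exists_right
    exact absurd (K.mem_center_of_commute hz hzN hdN (h d (K.le hdN)).symm)
      (K.split.noncentral_right d hd)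

end PrimeKernel

end PrimeKernel

/-! ### p-separability and commutativity of r-subgroups. -/

section Separable

variable {G : Type*} [Group G]

/-- The elementwise form of `p`-separability: a normal series whose factors have exponent a power of
`p` or prime to `p`. -/
def HasPSeries (p : ℕ) (G : Type*) [Group G] : Prop :=
  ∃ (n : ℕ) (N : ℕ → Subgroup G), N 0 = ⊥ ∧ N n = ⊤ ∧ (∀ i, (N i).Normal) ∧
    ∀ i < n, ∃ m : ℕ, ((∃ k, m = p ^ k) ∨ m.Coprime p) ∧ ∀ t ∈ N (i + 1), t ^ m ∈ N i

theorem IsPSeparable.hasPSeries {p : ℕ} (h : IsPSeparable p G) : HasPSeries p G := by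
  obtain ⟨n, N, h0, hn, hN, hi⟩ := h
  refine ⟨n, N, h0, hn, hN, fun i hin => ⟨(N i).relIndex (N (i + 1)), (hi i hin).2, fun t ht => ?_⟩⟩
  have := hN i
  exact Subgroup.pow_index_mem ((N i).subgroupOf (N (i + 1))) ⟨t, ht⟩

/-- The exponent form of the series survives taking images, so no index in the quotient has to be
computed. -/
theorem HasPSeries.quotient {p : ℕ} (h : HasPSeries p G) (W : Subgroup G) [W.Normal] :
    HasPSeries p (G ⧸ W) := by
  obtain ⟨n, N, h0, hn, hN, hi⟩ := h
  have hsurj := QuotientGroup.mk'_surjective W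
  refine ⟨n, fun i => (N i).map (QuotientGroup.mk' W), by simp [h0], ?_, fun i => (hN i).map _ hsurj,
    fun i hin => ?_⟩
  · change (N n).map _ = _
    rw [hn, Subgroup.map_top_of_surjective _ hsurj]
  · obtain ⟨m, hm, hmem⟩ := hi i hin
    refine ⟨m, hm, ?_⟩
    rintro _ ⟨t, ht, rfl⟩
    exact ⟨t ^ m, hmem t ht, by simp⟩

variable [Finite G]

/-- Supplies the radicals O_r and O_{r'}. -/
theorem exists_maximal_normal (P : Subgroup G → Prop) (hbot : P ⊥)
    (hsup : ∀ A B : Subgroup G, A.Normal → B.Normal → P A → P B → P (A ⊔ B)) :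
    ∃ L : Subgroup G, L.Normal ∧ P L ∧ ∀ T : Subgroup G, T.Normal → P T → T ≤ L := by
  obtain ⟨L, ⟨hL, hPL⟩, hmax⟩ := Set.exists_max_image {L : Subgroup G | L.Normal ∧ P L}
    (fun L => Nat.card L) (Set.toFinite _) ⟨⊥, inferInstance, hbot⟩
  refine ⟨L, hL, hPL, fun T hT hPT => ?_⟩
  have h1 := hmax (L ⊔ T) ⟨inferInstance, hsup L T hL hT hPL hPT⟩
  rw [Subgroup.eq_of_le_of_card_ge (le_sup_left : L ≤ L ⊔ T) h1]
  exact le_sup_right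

theorem not_dvd_card_of_forall {r : ℕ} (hr : r.Prime) {A : Subgroup G}
    (h : ∀ x ∈ A, ¬ r ∣ orderOf x) : ¬ r ∣ Nat.card A := fun hd => by
  have := Fact.mk hr
  obtain ⟨x, hx⟩ := exists_prime_orderOf_dvd_card' r hd
  exact h x x.2 (by rw [Subgroup.orderOf_coe, hx])

theorem isPGroup_of_forall_prime {r : ℕ}
    (h : ∀ ℓ : ℕ, ℓ.Prime → ℓ ∣ Nat.card G → ℓ = r) : IsPGroup r G :=
  IsPGroup.of_card (Nat.eq_prime_pow_of_unique_prime_dvd Nat.card_pos.ne' (h _ · ·))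

/-- Let L = O_r(G). Every r-element centralizes L, its length being prime to r. As O_p(G) = 1, the
Hall–Higman argument gives C(L) ≤ L. So x lies in L, which y centralizes. -/
theorem commute_of_hasPSeries {p r : ℕ} (hp : p.Prime) (hr : r.Prime) (hpr : r ≠ p)
    (hsep : HasPSeries p G) (hcard : ∀ ℓ : ℕ, ℓ.Prime → ℓ ∣ Nat.card G → ℓ = p ∨ ℓ = r)
    (hO : ∀ P : Subgroup G, P.Normal → IsPGroup p P → P = ⊥)
    (hcl : ∀ (x : G) (k : ℕ), orderOf x = r ^ k → ¬ r ∣ classLength x) {x y : G} {k l : ℕ}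
    (hx : orderOf x = r ^ k) (hy : orderOf y = r ^ l) : Commute x y := by
  have := Fact.mk hp
  have := Fact.mk hr
  obtain ⟨L, hL, hLr, hmax⟩ := exists_maximal_normal (G := G) (fun L => IsPGroup r L) IsPGroup.of_bot
    (fun A B _ _ hA hB => hA.to_sup_of_normal_right hB)
  have hcent : ∀ (x : G) (k : ℕ), orderOf x = r ^ k → ∀ m ∈ L, Commute m x := by
    intro x k hx
    obtain ⟨e, he⟩ := IsPGroup.iff_card.1 hLr
    exact le_centralizer_of_coprime (by
      rw [he]; exact Nat.Coprime.pow_left e (hr.coprime_iff_not_dvd.2 (hcl x k hx)))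
  have hle : ∀ T : Subgroup G, T.Normal → (∀ t ∈ T, ¬ p ∣ orderOf t) → T ≤ L := by
    intro T hT h
    refine hmax T hT (isPGroup_of_forall_prime fun ℓ hℓ hd => ?_)
    refine (hcard ℓ hℓ (hd.trans (Subgroup.card_subgroup_dvd_card T))).resolve_left ?_
    rintro rfl
    exact not_dvd_card_of_forall hp h hd
  set C := Subgroup.centralizer (L : Set G) with hC
  obtain ⟨n, N, h0, hn, hN, hi⟩ := hsep
  have key : ∀ i ≤ n, N i ⊓ C ≤ L := by
    intro i
    induction i with
    | zero => intro _; rw [h0]; exact inf_le_left.trans bot_le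
    | succ i ih =>
      intro hin
      have hNi := hN (i + 1)
      obtain ⟨m, hm, hmem⟩ := hi i hin
      set T := N (i + 1) ⊓ C with hT
      have hTn : T.Normal := inferInstance
      have hTm : ∀ t ∈ T, t ^ m ∈ L := fun t ht =>
        ih (by lia) ⟨hmem t ht.1, C.pow_mem ht.2 m⟩
      refine hle T hTn ?_
      rcases hm with ⟨k, rfl⟩ | hm
      -- For a p-factor, L ∩ T is central in T with p-group quotient, so T is nilpotent. Its Sylow
      -- p-subgroup is characteristic, hence normal in G and trivial.
      · have hker : (QuotientGroup.mk' (L.subgroupOf T)).ker ≤ Subgroup.center T := by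
          rw [QuotientGroup.ker_mk']
          intro l hl
          refine Subgroup.mem_center_iff.2 fun t => Subtype.ext ?_
          exact (Subgroup.mem_centralizer_iff.1 t.2.2 l hl).symm
        have hQ : IsPGroup p (T ⧸ L.subgroupOf T) := by
          intro c
          obtain ⟨t, rfl⟩ := QuotientGroup.mk_surjective c
          refine ⟨k, ?_⟩
          rw [← QuotientGroup.mk_pow, QuotientGroup.eq_one_iff]
          exact hTm t t.2
        have := hQ.isNilpotent
        have : Group.IsNilpotent T := Subgroup.isNilpotent_of_ker_le_center _ hker
        obtain ⟨P⟩ : Nonempty (Sylow p T) := inferInstance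
        have hPn : (P : Subgroup T).Normal := inferInstance
        have hPc := P.characteristic_of_normal hPn
        have h1 := hO ((P : Subgroup T).map T.subtype) inferInstance (P.isPGroup'.map _)
        rw [Subgroup.map_eq_bot_iff_of_injective _ T.subtype_injective] at h1
        intro t ht hd
        have h2 : p ∣ Nat.card T := hd.trans (Subgroup.orderOf_dvd_natCard T ht)
        have h3 := P.dvd_card_of_dvd_card h2
        rw [h1, Subgroup.card_bot] at h3
        exact hp.one_lt.ne' (Nat.dvd_one.1 h3)
      · intro t ht hd
        obtain ⟨e, he⟩ := hLr ⟨_, hTm t ht⟩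
        have h1 : t ^ (m * r ^ e) = 1 := by rw [pow_mul]; exact congrArg Subtype.val he
        rcases hp.dvd_mul.1 (hd.trans (orderOf_dvd_of_pow_eq_one h1)) with h | h
        · exact hp.coprime_iff_not_dvd.1 hm.symm h
        · exact hpr ((Nat.prime_dvd_prime_iff_eq hp hr).1 (hp.dvd_of_dvd_pow h)).symm
  have hxC : x ∈ C := Subgroup.mem_centralizer_iff.2 fun m hm => hcent x k hx m hm
  exact hcent y l hy x (key n le_rfl ⟨hn ▸ Subgroup.mem_top x, hxC⟩)

theorem exists_primary_lift {W : Subgroup G} [W.Normal] {ℓ k : ℕ} (hℓ : ℓ.Prime) {c : G ⧸ W}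
    (hc : orderOf c = ℓ ^ k) : ∃ (x : G) (l : ℕ), (x : G ⧸ W) = c ∧ orderOf x = ℓ ^ l := by
  obtain ⟨x, rfl⟩ := QuotientGroup.mk_surjective c
  obtain ⟨i, j, ⟨l, hl⟩, hj, hij⟩ := exists_pow_primary x hℓ
  refine ⟨x ^ i, l, ?_, hl⟩
  have h1 : ((x ^ j : G) : G ⧸ W) = 1 := by
    rw [← orderOf_eq_one_iff]
    refine Nat.eq_one_of_dvd_coprimes ((hℓ.coprime_iff_not_dvd.2 hj).pow_left k) ?_
      (orderOf_map_dvd (QuotientGroup.mk' W) _)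
    rw [QuotientGroup.mk_pow, ← hc]
    exact orderOf_pow_dvd j
  conv_rhs => rw [hij, QuotientGroup.mk_mul, h1, mul_one]

omit [Finite G] in
theorem classLength_mk_dvd (W : Subgroup G) [W.Normal] (x : G) :
    classLength (x : G ⧸ W) ∣ classLength x := by
  refine dvd_trans ?_ (Subgroup.index_map_dvd (Subgroup.centralizer ({x} : Set G))
    (QuotientGroup.mk'_surjective W))
  refine Subgroup.index_dvd_of_le ?_
  rintro _ ⟨g, hg, rfl⟩
  rw [SetLike.mem_coe, mem_centralizer_singleton] at hg
  exact mem_centralizer_singleton.2 (hg.map (QuotientGroup.mk' W))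

namespace PrimeKernel

variable {p q r : ℕ} {H N : Subgroup G} {U V : Set G}

theorem exists_primary_left (K : PrimeKernel p q r H N U V) :
    ∃ x ∈ H, x ∉ N ∧ ∃ k, orderOf x = r ^ k := by
  obtain ⟨b, hbH, hb⟩ := K.exists_left
  obtain ⟨n, k, hk, hn⟩ := K.exists_primary_not_mem hbH (fun h => K.disj b h hb)
  exact ⟨_, H.pow_mem hbH n, hn, k, hk⟩

theorem prime_r_ne_prime_p (K : PrimeKernel p q r H N U V) : r ≠ p := by
  rintro rfl
  obtain ⟨x, hx, hxN, k, hk⟩ := K.exists_primary_left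
  rcases k with _ | k
  · exact hxN (mem_of_orderOf_eq_pow_zero hk N)
  · exact K.regular K.prime_p hx (hk ▸ dvd_pow_self _ k.succ_ne_zero)

theorem mem_center_of_primary (K : PrimeKernel p q r H N U V) {x : G} (hx : x ∈ N) {k : ℕ}
    (hk : orderOf x = r ^ k) : x ∈ Subgroup.center G :=
  K.central x hx fun h => K.prime_r_ne_prime_q ((Nat.prime_dvd_prime_iff_eq K.prime_q K.prime_r).1
    (K.prime_q.dvd_of_dvd_pow (hk ▸ h))).symm

/-- r divides the length of some d ∈ N ∩ V, since otherwise an r-element of H outside N would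
commute with a conjugate of d. Coprimality then handles r-elements conjugate into H outside N; those
conjugate into N are central. -/
theorem not_dvd_classLength_primary (K : PrimeKernel p q r H N U V) (x : G) (k : ℕ)
    (hk : orderOf x = r ^ k) : ¬ r ∣ classLength x := by
  have hN := K.normal
  obtain ⟨d, hdN, hd⟩ := K.exists_right
  have hrd : r ∣ classLength d := by
    by_contra hrd
    obtain ⟨b, hb, hbN, l, hl⟩ := K.exists_primary_left
    obtain ⟨g, hg⟩ := exists_conj_commute_of_not_dvd K.prime_r hrd hl
    have hcomm : Commute b (g⁻¹ * d * g) := by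
      have h1 := hg.eq
      change b * (g⁻¹ * d * g) = (g⁻¹ * d * g) * b
      calc b * (g⁻¹ * d * g) = g⁻¹ * (g * b * g⁻¹ * d) * g := by group
        _ = g⁻¹ * (d * (g * b * g⁻¹)) * g := by rw [h1]
        _ = _ := by group
    have h1 := K.mem_center_of_commute hb hbN (by simpa using hN.conj_mem d hdN g⁻¹) hcomm
    exact K.split.noncentral_right d hd
      ((mem_center_iff_of_isConj (isConj_iff.2 ⟨g⁻¹, by simp⟩)).2 h1)
  obtain ⟨g, hg⟩ := K.compl.exists_conj_mem K.prime_p K.prime_r K.prime_r_ne_prime_p hk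
  have hconj := isConj_conj g x
  rw [classLength_eq_of_isConj hconj]
  by_cases hgN : g * x * g⁻¹ ∈ N
  · rw [classLength_eq_one_iff.2
      (K.mem_center_of_primary hgN ((orderOf_eq_of_isConj hconj).symm.trans hk))]
    exact K.prime_r.one_lt.ne' ∘ Nat.dvd_one.1
  · exact fun h => Nat.not_coprime_of_dvd_of_dvd K.prime_r.one_lt h hrd
      (K.split.coprime _ (K.mem_left K.prime_p hg hgN) d hd)

/-- Pass to G/W with W = O_{r'}(G). This is a {p, r}-group, because elements of any other prime
power order are conjugate to r'-elements of N, which lie in W. Commutators of R fall into R ∩ W = 1.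
-/
theorem commute_of_isPGroup (K : PrimeKernel p q r H N U V) (hsep : IsPSeparable p G)
    {R : Subgroup G} (hR : IsPGroup r R) : ∀ x ∈ R, ∀ y ∈ R, Commute x y := by
  have hN := K.normal
  have := Fact.mk K.prime_r
  have := Fact.mk K.prime_p
  obtain ⟨W, hW, hWr, hmax⟩ := exists_maximal_normal (G := G) (fun W => ¬ r ∣ Nat.card W)
    (by rw [Subgroup.card_bot]; exact K.prime_r.one_lt.ne' ∘ Nat.dvd_one.1)
    (fun A B hA hB h1 h2 h => by
      have h3 : Nat.card (A ⊔ B : Subgroup G) = Nat.card A * A.relIndex B := by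
        rw [← Subgroup.relIndex_sup_left, ← Subgroup.relIndex_bot_left, ← Subgroup.relIndex_bot_left,
          Subgroup.relIndex_mul_relIndex _ _ _ bot_le le_sup_left]
      rw [h3] at h
      exact (K.prime_r.dvd_mul.1 h).elim h1 fun h => h2 (h.trans (Subgroup.relIndex_dvd_card _ _)))
  have hWord : ∀ x ∈ W, ¬ r ∣ orderOf x := fun x hx h =>
    hWr (h.trans (Subgroup.orderOf_dvd_natCard W hx))
  have hNW : ∀ x ∈ N, ¬ r ∣ orderOf x → x ∈ W := by
    let A : Subgroup G :=
      { carrier := {x | x ∈ N ∧ ¬ r ∣ orderOf x}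
        one_mem' := ⟨N.one_mem, by rw [orderOf_one]; exact K.prime_r.one_lt.ne' ∘ Nat.dvd_one.1⟩
        mul_mem' := fun {x y} hx hy => ⟨N.mul_mem hx.1 hy.1,
          not_dvd_orderOf_mul K.prime_r (K.comm x hx.1 y hy.1) hx.2 hy.2⟩
        inv_mem' := fun {x} hx => ⟨N.inv_mem hx.1, by rw [orderOf_inv]; exact hx.2⟩ }
    have hA : A.Normal := ⟨fun x hx g => ⟨hN.conj_mem x hx.1 g, by
      rw [← orderOf_eq_of_isConj (isConj_conj g x)]; exact hx.2⟩⟩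
    exact fun x hx hxr => hmax A hA (not_dvd_card_of_forall K.prime_r fun y hy => hy.2) ⟨hx, hxr⟩
  have hcomm : ∀ (c d : G ⧸ W) (k l : ℕ), orderOf c = r ^ k → orderOf d = r ^ l → Commute c d := by
    intro c d k l hc hd
    refine commute_of_hasPSeries K.prime_p K.prime_r K.prime_r_ne_prime_p (hsep.hasPSeries.quotient W)
      ?_ ?_ ?_ hc hd
    · intro ℓ hℓ hdvd
      by_contra! hne
      have := Fact.mk hℓ
      obtain ⟨c, hc⟩ := exists_prime_orderOf_dvd_card' ℓ hdvd
      obtain ⟨x, l, rfl, hl⟩ := exists_primary_lift (k := 1) hℓ (by rw [hc, pow_one])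
      obtain ⟨g, hg⟩ := K.compl.exists_conj_mem K.prime_p hℓ hne.1 hl
      have hrx : ¬ r ∣ orderOf x := fun h => hne.2 ((Nat.prime_dvd_prime_iff_eq K.prime_r hℓ).1
        (K.prime_r.dvd_of_dvd_pow (hl ▸ h))).symm
      rw [orderOf_eq_of_isConj (isConj_conj g x)] at hrx
      have h1 := hW.conj_mem _ (hNW _ (K.mem_of_not_dvd hg hrx) hrx) g⁻¹
      have h2 : x ∈ W := by simpa [mul_assoc] using h1
      rw [(QuotientGroup.eq_one_iff x).2 h2, orderOf_one] at hc
      exact hℓ.one_lt.ne hc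
    · intro P hP hPp
      -- The preimage of a normal p-subgroup is again a normal r'-subgroup, so it lies in W and
      -- O_p(G/W) = 1.
      have h1 : P.comap (QuotientGroup.mk' W) ≤ W := by
        refine hmax _ (hP.comap _) fun hd => ?_
        obtain ⟨⟨y, hyP⟩, hy⟩ := exists_prime_orderOf_dvd_card' r hd
        rw [Subgroup.orderOf_mk] at hy
        obtain ⟨k, hk⟩ := IsPGroup.iff_orderOf.1 hPp ⟨_, Subgroup.mem_comap.1 hyP⟩
        rw [Subgroup.orderOf_mk] at hk
        have h2 : orderOf (QuotientGroup.mk' W y) = 1 := by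
          refine Nat.eq_one_of_dvd_coprimes (coprime_prime_pow K.prime_r K.prime_p
            K.prime_r_ne_prime_p 1 k) ?_ hk.dvd
          rw [pow_one, ← hy]; exact orderOf_map_dvd _ _
        rw [orderOf_eq_one_iff] at h2
        exact hWord y ((QuotientGroup.eq_one_iff y).1 h2) hy.symm.dvd
      rw [eq_bot_iff]
      intro c hc
      obtain ⟨y, rfl⟩ := QuotientGroup.mk_surjective c
      exact Subgroup.mem_bot.2 ((QuotientGroup.eq_one_iff y).2 (h1 hc))
    · intro c k hc
      obtain ⟨x, l, rfl, hl⟩ := exists_primary_lift K.prime_r hc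
      exact fun h => K.not_dvd_classLength_primary x l hl (h.trans (classLength_mk_dvd W x))
  have hRW : ∀ x ∈ R, x ∈ W → x = 1 := by
    intro x hx hxW
    obtain ⟨k, hk⟩ := IsPGroup.iff_orderOf.1 hR ⟨x, hx⟩
    rw [Subgroup.orderOf_mk] at hk
    rcases k with _ | k
    · exact orderOf_eq_one_iff.1 (by simpa using hk)
    · exact absurd (hk ▸ dvd_pow_self _ k.succ_ne_zero) (hWord x hxW)
  have hmk : ∀ x ∈ R, ∃ k, orderOf (x : G ⧸ W) = r ^ k := by
    intro x hx
    obtain ⟨k, hk⟩ := hR ⟨x, hx⟩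
    refine exists_orderOf_eq_of_pow (k := k) K.prime_r ?_
    rw [← QuotientGroup.mk_pow]
    have : x ^ r ^ k = 1 := congrArg Subtype.val hk
    rw [this]; rfl
  intro x hx y hy
  obtain ⟨k, hk⟩ := hmk x hx
  obtain ⟨l, hl⟩ := hmk y hy
  have h1 := (hcomm _ _ k l hk hl).eq
  have h2 : x * y * x⁻¹ * y⁻¹ ∈ W := by
    rw [← QuotientGroup.eq_one_iff]
    simp only [QuotientGroup.mk_mul, QuotientGroup.mk_inv]
    rw [mul_inv_eq_one, mul_inv_eq_iff_eq_mul, h1]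
  have h3 := hRW _ (R.mul_mem (R.mul_mem (R.mul_mem hx hy) (R.inv_mem hx)) (R.inv_mem hy)) h2
  rwa [mul_inv_eq_one, mul_inv_eq_iff_eq_mul] at h3

/-- H = NR for a Sylow r-subgroup R of H; modulo M, N is central and R is abelian. -/
theorem commutator_mem (K : PrimeKernel p q r H N U V) (hsep : IsPSeparable p G) {x y : G}
    (hx : x ∈ H) (hy : y ∈ H) : x * y * x⁻¹ * y⁻¹ ∈ ⁅(⊤ : Subgroup G), N⁆ := by
  have hN := K.normal
  have := Fact.mk K.prime_r
  have hMn := K.commutator_normal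
  set M := ⁅(⊤ : Subgroup G), N⁆ with hM
  obtain ⟨R⟩ : Nonempty (Sylow r H) := inferInstance
  have htop : N.subgroupOf H ⊔ R = ⊤ := by
    rw [← Subgroup.index_eq_one]
    obtain ⟨a, ha⟩ := K.relIndex_eq_pow
    refine Nat.eq_one_of_dvd_coprimes
      (Nat.Coprime.pow_left a (K.prime_r.coprime_iff_not_dvd.2 R.not_dvd_index))
      (ha ▸ Subgroup.index_dvd_of_le le_sup_left) (Subgroup.index_dvd_of_le le_sup_right)
  have hdec : ∀ x ∈ H, ∃ n ∈ N, ∃ t ∈ (R : Subgroup H).map H.subtype, n * t = x := by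
    intro x hx
    have h1 : (⟨x, hx⟩ : H) ∈ N.subgroupOf H ⊔ R := htop ▸ Subgroup.mem_top _
    obtain ⟨n, hn, t, ht, e⟩ := Subgroup.mem_sup_of_normal_left.1 h1
    exact ⟨n, hn, t, ⟨t, ht, rfl⟩, congrArg Subtype.val e⟩
  have hR := K.commute_of_isPGroup hsep (R.isPGroup'.map H.subtype)
  have hcent : ∀ n ∈ N, ∀ g : G, Commute (n : G ⧸ M) g := by
    intro n hn g
    have h1 := commutator_top_mem hn g
    rw [← hM, ← QuotientGroup.eq_one_iff] at h1
    simp only [QuotientGroup.mk_mul, QuotientGroup.mk_inv] at h1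
    rw [mul_inv_eq_one, mul_inv_eq_iff_eq_mul] at h1
    exact h1.symm
  obtain ⟨n, hn, t, ht, rfl⟩ := hdec x hx
  obtain ⟨m, hm, s, hs, rfl⟩ := hdec y hy
  have h1 : Commute ((n * t : G) : G ⧸ M) ((m * s : G) : G ⧸ M) := by
    change Commute ((n : G ⧸ M) * t) ((m : G ⧸ M) * s)
    refine Commute.mul_left (hcent n hn _) ?_
    exact Commute.mul_right (hcent m hm t).symm ((hR t ht s hs).map (QuotientGroup.mk' M))
  rw [← QuotientGroup.eq_one_iff]
  simp only [QuotientGroup.mk_mul, QuotientGroup.mk_inv] at h1 ⊢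
  rw [mul_inv_eq_one, mul_inv_eq_iff_eq_mul]
  exact h1.eq

end PrimeKernel

end Separable

/-! ### The centre of H and the Frobenius structure of its central quotient. -/

section Frobenius

variable {G : Type*} [Group G]

/-- One common exponent extracts the ℓ'-parts z and z'; they are conjugate and central, hence equal.
-/
theorem isConj_mul_central_cancel {d z z' : G} {ℓ k : ℕ} (hℓ : ℓ.Prime) (hd : orderOf d = ℓ ^ k)
    (hz : z ∈ Subgroup.center G) (hz' : z' ∈ Subgroup.center G) (h : ¬ ℓ ∣ orderOf z)
    (h' : ¬ ℓ ∣ orderOf z') (hc : IsConj (d * z) (d * z')) : z = z' := by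
  have hcop : (ℓ ^ k).Coprime (orderOf z * orderOf z') := Nat.Coprime.pow_left k
    ((hℓ.coprime_iff_not_dvd.2 h).mul_right (hℓ.coprime_iff_not_dvd.2 h'))
  obtain ⟨n, hn⟩ := exists_pow_mul_eq_right (G := G) hcop
  have e1 := hn d z (Subgroup.mem_center_iff.1 hz d) (pow_order_pow hd)
    (orderOf_dvd_iff_pow_eq_one.1 (dvd_mul_right _ _))
  have e2 := hn d z' (Subgroup.mem_center_iff.1 hz' d) (pow_order_pow hd)
    (orderOf_dvd_iff_pow_eq_one.1 (dvd_mul_left _ _))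
  obtain ⟨g, hg⟩ := isConj_iff.1 hc
  rw [← hg, conj_pow, e1, Subgroup.mem_center_iff.1 hz g, mul_inv_cancel_right] at e2
  exact e2

namespace PrimeKernel

variable [Finite G] {p q r : ℕ} {H N : Subgroup G} {U V : Set G}

omit [Finite G] in
-- Compare x, y, xz in U: the order of xz is not a power of r.
theorem isConj_of_primary (K : PrimeKernel p q r H N U V) {x y z : G} (hx : x ∈ H) (hxN : x ∉ N)
    (hy : y ∈ H) (hyN : y ∉ N) {k l : ℕ} (hxo : orderOf x = r ^ k) (hyo : orderOf y = r ^ l)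
    (hz : z ∈ H) (hzc : z ∈ Subgroup.center G) (hzr : ¬ r ∣ orderOf z) (hz1 : z ≠ 1) :
    IsConj x y := by
  have hmul : x * z ∉ N := fun h => hxN
    (by simpa using N.mul_mem h (N.inv_mem (K.center_mem z hz hzc)))
  have h1 : ¬ r ∣ orderOf (1 : G) := by
    rw [orderOf_one]; exact K.prime_r.one_lt.ne' ∘ Nat.dvd_one.1
  have hmem := fun {u : G} (hu : u ∈ H) (huN : u ∉ N) => K.mem_left K.prime_p hu huN
  rcases K.split.three_left x (hmem hx hxN) y (hmem hy hyN) (x * z) (hmem (H.mul_mem hx hz) hmul)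
    with h | h | h
  · exact h
  · exact absurd (isConj_mul_central_cancel K.prime_r hxo (one_mem _) hzc h1 hzr
      (by rwa [mul_one])).symm hz1
  · exfalso
    have h2 := orderOf_eq_of_isConj h
    have hxz : Commute x z := Subgroup.mem_center_iff.1 hzc x
    rw [hxz.orderOf_mul_eq_mul_orderOf_of_coprime
      (by rw [hxo]; exact (K.prime_r.coprime_iff_not_dvd.2 hzr).pow_left k), hyo] at h2
    obtain ⟨e, -, he⟩ := (Nat.dvd_prime_pow K.prime_r).1 (h2 ▸ Nat.dvd_mul_left _ _ :
      orderOf z ∣ r ^ l)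
    rcases e with _ | e
    · exact hz1 (orderOf_eq_one_iff.1 (by simpa using he))
    · exact hzr (he ▸ dvd_pow_self _ e.succ_ne_zero)

/-- Comparing x, xz, xz² forces z² = 1. If z ≠ 1, then r is odd and x is conjugate to x⁻¹; a
2-element inverting x lies in N, which drags x into N. -/
theorem eq_one_of_central (K : PrimeKernel p q r H N U V) {z : G} (hz : z ∈ H)
    (hzc : z ∈ Subgroup.center G) (hzr : ¬ r ∣ orderOf z) : z = 1 := by
  by_contra hz1
  have hN := K.normal
  obtain ⟨x, hx, hxN, k, hk⟩ := K.exists_primary_left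
  have hz2 : orderOf z = 2 := by
    rw [orderOf_eq_prime_iff]
    refine ⟨?_, hz1⟩
    by_contra hz2
    have h1 : ¬ r ∣ orderOf (1 : G) := by
      rw [orderOf_one]; exact K.prime_r.one_lt.ne' ∘ Nat.dvd_one.1
    have hmem : ∀ w ∈ H, w ∈ Subgroup.center G → x * w ∈ U := fun w hw hwc =>
      K.mem_left K.prime_p (H.mul_mem hx hw) fun h => hxN
        (by simpa using N.mul_mem h (N.inv_mem (K.center_mem w hw hwc)))
    have hsq := Subgroup.pow_mem _ hzc 2
    have hsqr := orderOf_pow_not_dvd hzr 2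
    rcases K.split.three_left _ (hmem 1 H.one_mem (one_mem _)) _ (hmem z hz hzc) _
      (hmem (z ^ 2) (H.pow_mem hz 2) hsq) with h | h | h
    · exact hz1 (isConj_mul_central_cancel K.prime_r hk (one_mem _) hzc h1 hzr h).symm
    · exact hz2 (isConj_mul_central_cancel K.prime_r hk (one_mem _) hsq h1 hsqr h).symm
    · exact hz1 (by
        simpa [sq] using isConj_mul_central_cancel K.prime_r hk hzc hsq hzr hsqr h)
  have h2p : 2 ≠ p := fun h => K.regular K.prime_p hz (by rw [hz2, h])
  have h2r : 2 ≠ r := fun h => hzr (by rw [hz2, h])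
  have hxinv : orderOf x⁻¹ = r ^ k := by rw [orderOf_inv, hk]
  obtain ⟨g, hg⟩ := isConj_iff.1 (K.isConj_of_primary hx hxN (H.inv_mem hx)
    (fun h => hxN (by simpa using N.inv_mem h)) hk hxinv hz hzc hzr hz1)
  -- Raising g to the odd part of its order gives a 2-element u that still inverts x.
  obtain ⟨a, m, hm, hgo⟩ := Nat.exists_eq_pow_mul_and_not_dvd (orderOf_pos g).ne' 2 (by norm_num)
  have hpow : ∀ j : ℕ, g ^ (2 * j + 1) * x * (g ^ (2 * j + 1))⁻¹ = x⁻¹ := by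
    intro j
    induction j with
    | zero => simpa using hg
    | succ j ih =>
      have e1 : g * x⁻¹ * g⁻¹ = x := by rw [← conj_inv, hg, inv_inv]
      have e2 : g ^ (2 * (j + 1) + 1) = g * (g * g ^ (2 * j + 1)) := by
        rw [← pow_succ', ← pow_succ']
        congr 1
      calc _ = g * (g * (g ^ (2 * j + 1) * x * (g ^ (2 * j + 1))⁻¹) * g⁻¹) * g⁻¹ := by
            rw [e2]; group
        _ = _ := by rw [ih, e1, hg]
  obtain ⟨j, rfl⟩ : ∃ j, m = 2 * j + 1 := Nat.odd_iff.2 (by lia)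
  set u := g ^ (2 * j + 1) with hu
  obtain ⟨l, hl⟩ := exists_orderOf_eq_of_pow (x := u) (k := a) Nat.prime_two (by
    rw [hu, ← pow_mul, mul_comm, ← hgo, pow_orderOf_eq_one])
  obtain ⟨t, ht⟩ := K.compl.exists_conj_mem K.prime_p Nat.prime_two h2p hl
  have htN : t * u * t⁻¹ ∈ N := by
    refine K.mem_of_not_dvd ht fun h => ?_
    rw [← orderOf_eq_of_isConj (isConj_conj t u), hl] at h
    exact h2r ((Nat.prime_dvd_prime_iff_eq K.prime_r Nat.prime_two).1
      (K.prime_r.dvd_of_dvd_pow h)).symm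
  have huN : u ∈ N := by simpa [mul_assoc] using hN.conj_mem _ htN t⁻¹
  -- [u, x] = x⁻² lies in N because u does.
  have hx2 : x ^ 2 ^ 1 ∈ N := by
    have h1 : u * (x * u⁻¹ * x⁻¹) ∈ N := N.mul_mem huN (hN.conj_mem _ (N.inv_mem huN) x)
    have h2 : u * (x * u⁻¹ * x⁻¹) = (x ^ 2 ^ 1)⁻¹ := by
      calc u * (x * u⁻¹ * x⁻¹) = u * x * u⁻¹ * x⁻¹ := by group
        _ = _ := by rw [hpow j]; group
    rw [h2] at h1
    simpa using N.inv_mem h1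
  refine hxN (mem_of_pow_mem_of_not_dvd Nat.prime_two hx2 fun h => ?_)
  rw [hk] at h
  exact h2r ((Nat.prime_dvd_prime_iff_eq Nat.prime_two K.prime_r).1
    (Nat.prime_two.dvd_of_dvd_pow h))

/-- Central elements of H are q'-elements by `eq_one_of_central`. For a non-central q-element d of
N, compare d, dz, dw in V. -/
theorem eq_of_central (K : PrimeKernel p q r H N U V) {z w : G} (hz : z ∈ H) (hw : w ∈ H)
    (hzc : z ∈ Subgroup.center G) (hwc : w ∈ Subgroup.center G) (hz1 : z ≠ 1) (hw1 : w ≠ 1) :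
    z = w := by
  have hq : ∀ z ∈ H, z ∈ Subgroup.center G → ¬ q ∣ orderOf z := by
    intro z hz hzc hd
    have h1 : orderOf (z ^ (orderOf z / q)) = q := orderOf_pow_orderOf_div (orderOf_pos z).ne' hd
    rw [K.eq_one_of_central (H.pow_mem hz _) (Subgroup.pow_mem _ hzc _) (fun h => by
      rw [h1] at h
      exact K.prime_r_ne_prime_q ((Nat.prime_dvd_prime_iff_eq K.prime_r K.prime_q).1 h)),
      orderOf_one] at h1
    exact K.prime_q.one_lt.ne h1
  obtain ⟨d, hd, hdc, k, hk⟩ := K.exists_noncentral_of_dvd K.prime_q K.dvd_card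
  have hmem : ∀ w ∈ H, w ∈ Subgroup.center G → d * w ∈ V := fun w hw hwc =>
    K.mem_right K.prime_p (N.mul_mem hd (K.center_mem w hw hwc)) fun h => hdc
      (by simpa using mul_mem h (inv_mem hwc))
  have h1 : ¬ q ∣ orderOf (1 : G) := hq 1 H.one_mem (one_mem _)
  rcases K.split.three_right _ (hmem 1 H.one_mem (one_mem _)) _ (hmem z hz hzc) _ (hmem w hw hwc)
    with h | h | h
  · exact absurd (isConj_mul_central_cancel K.prime_q hk (one_mem _) hzc h1 (hq z hz hzc) h).symm hz1
  · exact absurd (isConj_mul_central_cancel K.prime_q hk (one_mem _) hwc h1 (hq w hw hwc) h).symm hw1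
  · exact isConj_mul_central_cancel K.prime_q hk hzc hwc (hq z hz hzc) (hq w hw hwc) h

theorem mem_center_iff (K : PrimeKernel p q r H N U V) {z : H} :
    z ∈ Subgroup.center H ↔ (z : G) ∈ Subgroup.center G := by
  rw [← K.center_le_iff z.2, Subgroup.mem_center_iff]
  exact ⟨fun h g hg => congrArg Subtype.val (h ⟨g, hg⟩), fun h g => Subtype.ext (h g g.2)⟩

theorem map_center (K : PrimeKernel p q r H N U V) :
    (Subgroup.center H).map H.subtype = H ⊓ Subgroup.center G := by
  ext z
  rw [Subgroup.mem_inf]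
  constructor
  · rintro ⟨z, hz, rfl⟩
    exact ⟨z.2, K.mem_center_iff.1 hz⟩
  · exact fun h => ⟨⟨z, h.1⟩, K.mem_center_iff.2 h.2, rfl⟩

theorem card_center (K : PrimeKernel p q r H N U V) :
    Nat.card (Subgroup.center H) = 1 ∨
      (IsCyclic (Subgroup.center H) ∧ Nat.card (Subgroup.center H) = 2) := by
  by_cases h : ∃ z : Subgroup.center H, z ≠ 1
  · right
    obtain ⟨z, hz⟩ := h
    have hcard : Nat.card (Subgroup.center H) = 2 := by
      rw [Nat.card_eq_two_iff' 1]
      refine ⟨z, hz, fun w hw => ?_⟩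
      have hne : ∀ w : Subgroup.center H, w ≠ 1 → ((w : H) : G) ≠ 1 := fun w hw h =>
        hw (Subtype.ext (Subtype.ext h))
      exact Subtype.ext (Subtype.ext (K.eq_of_central w.1.2 z.1.2 (K.mem_center_iff.1 w.2)
        (K.mem_center_iff.1 z.2) (hne w hw) (hne z hz)))
    have := Fact.mk Nat.prime_two
    exact ⟨isCyclic_of_prime_card hcard, hcard⟩
  · left
    push Not at h
    rw [Nat.card_eq_one_iff_unique]
    exact ⟨⟨fun x y => (h x).trans (h y).symm⟩, ⟨1⟩⟩

theorem primeFactors_card (K : PrimeKernel p q r H N U V) :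
    (Nat.card H).primeFactors = {q, r} := by
  ext s
  rw [Nat.mem_primeFactors_of_ne_zero Nat.card_pos.ne', Finset.mem_insert, Finset.mem_singleton]
  constructor
  · rintro ⟨hs, hd⟩
    by_contra! hne
    have := Fact.mk hs
    obtain ⟨⟨y, hy⟩, hyo⟩ := exists_prime_orderOf_dvd_card' s hd
    rw [Subgroup.orderOf_mk] at hyo
    have hr : ¬ r ∣ orderOf y := fun h => hne.2
      ((Nat.prime_dvd_prime_iff_eq K.prime_r hs).1 (hyo ▸ h)).symm
    have hq : ¬ q ∣ orderOf y := fun h => hne.1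
      ((Nat.prime_dvd_prime_iff_eq K.prime_q hs).1 (hyo ▸ h)).symm
    have h1 := K.eq_one_of_central hy (K.central y (K.mem_of_not_dvd hy hr) hq) hr
    rw [h1, orderOf_one] at hyo
    exact hs.one_lt.ne hyo
  · rintro (rfl | rfl)
    · exact ⟨K.prime_q, K.dvd_card.trans (Subgroup.card_dvd_of_le (K.commutator_le.trans K.le))⟩
    · refine ⟨K.prime_r, ?_⟩
      obtain ⟨x, hx, hxN, k, hk⟩ := K.exists_primary_left
      rcases k with _ | k
      · exact absurd (mem_of_orderOf_eq_pow_zero hk N) hxN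
      · exact (hk ▸ dvd_pow_self s k.succ_ne_zero : s ∣ orderOf x).trans
          (Subgroup.orderOf_dvd_natCard H hx)

omit [Finite G] in
theorem prime_q_ne_prime_p (K : PrimeKernel p q r H N U V) : q ≠ p := by
  rintro rfl
  have h1 := K.dvd_card.trans (Subgroup.card_dvd_of_le (K.commutator_le.trans K.le))
  exact K.prime_q.coprime_iff_not_dvd.1 K.compl.1.symm h1

/-- For `c` in `H` outside `N`, the coset `c [G, N]` is an orbit of `[G, N]` acting by conjugation. -/
theorem exists_conj_eq_mul (K : PrimeKernel p q r H N U V) {c m : G} (hc : c ∈ H) (hcN : c ∉ N)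
    (hm : m ∈ ⁅(⊤ : Subgroup G), N⁆) : ∃ n ∈ ⁅(⊤ : Subgroup G), N⁆, n * c * n⁻¹ = c * m := by
  have hMn := K.commutator_normal
  set M := ⁅(⊤ : Subgroup G), N⁆ with hM
  let f : M → M := fun n => ⟨c⁻¹ * n * c * (n : G)⁻¹, M.mul_mem
    (by simpa using hMn.conj_mem n n.2 c⁻¹) (M.inv_mem n.2)⟩
  -- Equal values put n'⁻¹n in C_M(c), which is contained in M ∩ Z(G) = 1.
  have hf : Function.Injective f := by
    intro n n' h
    have h1 : c⁻¹ * n * c * (n : G)⁻¹ = c⁻¹ * n' * c * (n' : G)⁻¹ := congrArg Subtype.val h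
    have h2 : Commute c ((n' : G)⁻¹ * n) := by
      have h3 : (n : G) * c * (n : G)⁻¹ = n' * c * (n' : G)⁻¹ := by simpa [mul_assoc] using h1
      change c * ((n' : G)⁻¹ * n) = (n' : G)⁻¹ * n * c
      calc c * ((n' : G)⁻¹ * n) = (n' : G)⁻¹ * (n' * c * (n' : G)⁻¹) * n := by group
        _ = _ := by rw [← h3]; group
    have h4 := M.mul_mem (M.inv_mem n'.2) n.2
    have h5 := K.commutator_inf_center h4 (K.mem_center_of_commute hc hcN (K.commutator_le h4) h2)
    exact Subtype.ext (inv_mul_eq_one.1 h5).symm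
  obtain ⟨n, hn⟩ := Finite.injective_iff_surjective.1 hf ⟨m, hm⟩
  refine ⟨n, n.2, ?_⟩
  have h1 : c⁻¹ * n * c * (n : G)⁻¹ = m := congrArg Subtype.val hn
  rw [← h1]; group

/-- A Frattini argument: ycy⁻¹ lies in cM, hence equals ncn⁻¹ for some n ∈ M. -/
theorem exists_mul_commute (K : PrimeKernel p q r H N U V) (hsep : IsPSeparable p G) {c y : G}
    (hc : c ∈ H) (hcN : c ∉ N) (hy : y ∈ H) :
    ∃ n ∈ ⁅(⊤ : Subgroup G), N⁆, Commute (n⁻¹ * y) c := by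
  obtain ⟨n, hn, h⟩ := K.exists_conj_eq_mul hc hcN (K.commutator_mem hsep (H.inv_mem hc) hy)
  refine ⟨n, hn, ?_⟩
  have h1 : n * c * n⁻¹ = y * c * y⁻¹ := by rw [h]; group
  change n⁻¹ * y * c = c * (n⁻¹ * y)
  calc n⁻¹ * y * c = n⁻¹ * (y * c * y⁻¹) * y := by group
    _ = _ := by rw [← h1]; group

theorem commute_of_mk (K : PrimeKernel p q r H N U V) (hsep : IsPSeparable p G) {x y : H}
    (h : (x : H ⧸ Subgroup.center H) * y = y * x) : x * y = y * x := by
  have h1 : x * y * x⁻¹ * y⁻¹ ∈ Subgroup.center H := by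
    rw [← QuotientGroup.eq_one_iff]
    simp only [QuotientGroup.mk_mul, QuotientGroup.mk_inv]
    rw [mul_inv_eq_one, mul_inv_eq_iff_eq_mul, h]
  have h2 := K.commutator_inf_center (K.commutator_mem hsep x.2 y.2) (K.mem_center_iff.1 h1)
  exact Subtype.ext (by rwa [mul_inv_eq_one, mul_inv_eq_iff_eq_mul] at h2)

/-- The kernel is the image of N, and a complement is the image of C_H(c) for any c in H outside N.
-/
theorem isQuasiFrobenius (K : PrimeKernel p q r H N U V) (hsep : IsPSeparable p G) :
    IsQuasiFrobenius H := by
  have hN := K.normal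
  obtain ⟨c, hc, hcN, -⟩ := K.exists_primary_left
  obtain ⟨d, hdN, hd⟩ := K.exists_right
  have hmem : ∀ z : H, (z : H ⧸ Subgroup.center H) = 1 ↔ (z : G) ∈ Subgroup.center G := fun z => by
    rw [QuotientGroup.eq_one_iff, K.mem_center_iff]
  have hcent : ∀ x : H, x ∈ Subgroup.centralizer ({⟨c, hc⟩} : Set H) → (x : G) ∈ N →
      (x : H ⧸ Subgroup.center H) = 1 := by
    intro x hx hxN
    rw [mem_centralizer_singleton] at hx
    exact (hmem x).2 (K.mem_center_of_commute hc hcN hxN (congrArg Subtype.val hx.eq.symm))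
  refine ⟨(N.subgroupOf H).map (QuotientGroup.mk' _),
    (Subgroup.centralizer ({⟨c, hc⟩} : Set H)).map (QuotientGroup.mk' _), ?_, ?_, ?_, ?_, ?_⟩
  · exact Subgroup.Normal.map inferInstance _ (QuotientGroup.mk'_surjective _)
  · refine Subgroup.isComplement'_of_disjoint_and_mul_eq_univ ?_ ?_
    · rw [Subgroup.disjoint_def]
      rintro _ ⟨n, hn, rfl⟩ ⟨x, hx, hxn⟩
      rw [QuotientGroup.mk'_apply, QuotientGroup.mk'_apply, QuotientGroup.eq] at hxn
      refine hcent n ?_ hn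
      have h1 : n = x * (x⁻¹ * n) := by group
      rw [h1]
      exact Subgroup.mul_mem _ hx (Subgroup.center_le_centralizer _ hxn)
    · rw [Set.eq_univ_iff_forall]
      intro y
      obtain ⟨y, rfl⟩ := QuotientGroup.mk_surjective y
      obtain ⟨n, hn, hny⟩ := K.exists_mul_commute hsep hc hcN y.2
      have hnN := K.commutator_le hn
      refine ⟨_, ⟨⟨n, K.le hnN⟩, hnN, rfl⟩, _, ⟨⟨n, K.le hnN⟩⁻¹ * y, ?_, rfl⟩, ?_⟩
      · exact mem_centralizer_singleton.2 (Subtype.ext hny)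
      · change (QuotientGroup.mk' _ _) * (QuotientGroup.mk' _ _) = QuotientGroup.mk' _ _
        rw [← map_mul, mul_inv_cancel_left]
  · intro h
    have h1 : ((⟨d, K.le hdN⟩ : H) : H ⧸ Subgroup.center H) ∈
      (N.subgroupOf H).map (QuotientGroup.mk' (Subgroup.center H)) := ⟨_, hdN, rfl⟩
    rw [h, Subgroup.mem_bot, hmem] at h1
    exact K.split.noncentral_right d hd h1
  · intro h
    have h1 : ((⟨c, hc⟩ : H) : H ⧸ Subgroup.center H) ∈
      (Subgroup.centralizer ({⟨c, hc⟩} : Set H)).map (QuotientGroup.mk' (Subgroup.center H)) :=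
      ⟨_, mem_centralizer_singleton.2 (Commute.refl _), rfl⟩
    rw [h, Subgroup.mem_bot, hmem] at h1
    exact hcN (K.center_mem c hc h1)
  · rintro _ ⟨x, hx, rfl⟩ _ ⟨n, hn, rfl⟩ hx1 hn1 h
    have h1 := K.commute_of_mk hsep h
    exact hn1 ((hmem n).2 (K.mem_center_of_commute x.2 (fun hxN => hx1 (hcent x hx hxN)) hn
      (congrArg Subtype.val h1)))

/-- For an arbitrary Frobenius decomposition, the preimage A' of the kernel turns out to lie in N,
and the preimage C' of the complement meets N only in the centre, so its commutators are central and
hence trivial. -/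
theorem isMulCommutative_of_isFrobeniusWith (K : PrimeKernel p q r H N U V)
    (hsep : IsPSeparable p G) {A C : Subgroup (H ⧸ Subgroup.center H)} (F : IsFrobeniusWith A C) :
    IsMulCommutative (A.comap (QuotientGroup.mk' (Subgroup.center H))) ∧
      IsMulCommutative (C.comap (QuotientGroup.mk' (Subgroup.center H))) := by
  have hN := K.normal
  have hA := F.normal
  have := Fact.mk K.prime_r
  set A' := A.comap (QuotientGroup.mk' (Subgroup.center H)) with hA'
  set C' := C.comap (QuotientGroup.mk' (Subgroup.center H)) with hC'
  have hA'n : A'.Normal := hA.comap _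
  have hmem : ∀ z : H, (z : H ⧸ Subgroup.center H) = 1 ↔ z ∈ Subgroup.center H := fun z =>
    QuotientGroup.eq_one_iff z
  have hle : ∀ (B : Subgroup (H ⧸ Subgroup.center H)) (z : H), z ∈ Subgroup.center H →
      z ∈ B.comap (QuotientGroup.mk' (Subgroup.center H)) := fun B z hz => by
    rw [Subgroup.mem_comap, QuotientGroup.mk'_apply, (hmem z).2 hz]; exact B.one_mem
  have hfree : ∀ x ∈ C', ∀ n ∈ A', x * n = n * x → x ∉ Subgroup.center H →
      n ∈ Subgroup.center H := by
    intro x hx n hn h hxc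
    by_contra hnc
    exact F.fixedPointFree _ hx _ hn (mt (hmem x).1 hxc) (mt (hmem n).1 hnc)
      (congrArg (QuotientGroup.mk' (Subgroup.center H)) h)
  have hexists : ∀ B : Subgroup (H ⧸ Subgroup.center H), B ≠ ⊥ →
      ∃ x ∈ B.comap (QuotientGroup.mk' (Subgroup.center H)), x ∉ Subgroup.center H := by
    intro B hB
    obtain ⟨⟨y, hy⟩, hy1⟩ := B.ne_bot_iff_exists_ne_one.1 hB
    obtain ⟨x, rfl⟩ := QuotientGroup.mk_surjective y
    exact ⟨x, hy, fun h => hy1 (Subtype.ext ((hmem x).2 h))⟩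
  have hcomm : ∀ x y : H, ((x * y * x⁻¹ * y⁻¹ : H) : G) ∈ N := fun x y =>
    K.commutator_le (K.commutator_mem hsep x.2 y.2)
  have heq : ∀ x y : H, x * y * x⁻¹ * y⁻¹ ∈ Subgroup.center H → x * y = y * x := by
    intro x y h
    have h2 := K.commutator_inf_center (K.commutator_mem hsep x.2 y.2) (K.mem_center_iff.1 h)
    exact Subtype.ext (by rwa [mul_inv_eq_one, mul_inv_eq_iff_eq_mul] at h2)
  -- For n ∈ A', the commutator [x, n] lies in A' and in the abelian N, so it commutes with x.
  -- Fixed-point-freeness makes it central, hence trivial, and applied again it makes n central.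
  have hCN : ∀ x ∈ C', (x : G) ∈ N → x ∈ Subgroup.center H := by
    intro x hx hxN
    by_contra hxc
    obtain ⟨n, hn, hnc⟩ := hexists A F.kernel_ne_bot
    by_cases hw : x * n * x⁻¹ * n⁻¹ ∈ Subgroup.center H
    · exact hnc (hfree x hx n hn (heq x n hw) hxc)
    · refine hw (hfree x hx _ (A'.mul_mem (hA'n.conj_mem n hn x) (A'.inv_mem hn)) ?_ hxc)
      exact Subtype.ext (K.comm x hxN _ (hcomm x n)).eq
  have hCpow : IsPGroup r C := by
    rintro ⟨y, hy⟩
    obtain ⟨x, rfl⟩ := QuotientGroup.mk_surjective y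
    obtain ⟨k, hk⟩ := K.pow_mem x x.2
    refine ⟨k, Subtype.ext ?_⟩
    have h1 := (hmem _).2 (hCN (x ^ r ^ k) (C'.pow_mem hy _) hk)
    rw [QuotientGroup.mk_pow] at h1
    exact h1
  -- The index of A' is |C|, a power of r, so A' contains all q-elements; the q'-elements of N are
  -- central.
  have hNA : ∀ n : H, (n : G) ∈ N → n ∈ A' := by
    intro n hn
    obtain ⟨a, ha⟩ := IsPGroup.iff_card.1 hCpow
    obtain ⟨i, j, ⟨l, hl⟩, hj, hij⟩ := exists_pow_primary n K.prime_q
    rw [hij]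
    refine A'.mul_mem ?_ (hle A _ (K.mem_center_iff.2 (K.central _ (N.pow_mem hn j) ?_)))
    · refine mem_of_pow_mem_of_not_dvd (k := a) K.prime_r ?_ ?_
      · have h1 : A'.index = r ^ a := by
          rw [hA', Subgroup.index_comap_of_surjective _ (QuotientGroup.mk'_surjective _),
            F.isComplement.symm.index_eq_card, ha]
        rw [← h1]
        exact Subgroup.pow_index_mem A' _
      · rw [hl]
        exact fun h => K.prime_r_ne_prime_q ((Nat.prime_dvd_prime_iff_eq K.prime_r K.prime_q).1
          (K.prime_r.dvd_of_dvd_pow h))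
    · rwa [← Subgroup.orderOf_coe] at hj
  -- Write x = n(n⁻¹x) with n ∈ M and n⁻¹x commuting with a non-central c ∈ C'. Then n⁻¹x ∈ A' is
  -- central, so it lies in N.
  have hAN : ∀ x ∈ A', (x : G) ∈ N := by
    intro x hx
    obtain ⟨c, hc, hcc⟩ := hexists C F.complement_ne_bot
    obtain ⟨n, hn, hcomm⟩ := K.exists_mul_commute hsep c.2 (fun h => hcc (hCN c hc h)) x.2
    have hnN := K.commutator_le hn
    let n' : H := ⟨n, K.le hnN⟩
    have h1 : n'⁻¹ * x ∈ Subgroup.center H := hfree c hc _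
      (A'.mul_mem (A'.inv_mem (hNA n' hnN)) hx) (Subtype.ext hcomm.eq.symm) hcc
    have h2 := N.mul_mem hnN (K.center_mem _ (n'⁻¹ * x).2 (K.mem_center_iff.1 h1))
    simpa [n'] using h2
  refine ⟨⟨⟨fun x y => Subtype.ext (Subtype.ext ?_)⟩⟩, ⟨⟨fun x y => Subtype.ext ?_⟩⟩⟩
  · exact (K.comm _ (hAN x x.2) _ (hAN y y.2)).eq
  · refine heq x y (hCN _ ?_ (hcomm x y))
    exact C'.mul_mem (C'.mul_mem (C'.mul_mem x.2 y.2) (C'.inv_mem x.2)) (C'.inv_mem y.2)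

theorem conclusion (K : PrimeKernel p q r H N U V) (hsep : IsPSeparable p G) :
    (Subgroup.center H).map H.subtype = H ⊓ Subgroup.center G ∧
      IsQuasiFrobeniusAbelian H ∧
      (∃ q r : ℕ, q.Prime ∧ r.Prime ∧ q ≠ r ∧ q ≠ p ∧ r ≠ p ∧
        (Nat.card H).primeFactors = {q, r}) ∧
      (Nat.card (Subgroup.center H) = 1 ∨
        (IsCyclic (Subgroup.center H) ∧ Nat.card (Subgroup.center H) = 2)) :=
  ⟨K.map_center, ⟨K.isQuasiFrobenius hsep, fun _ _ F => K.isMulCommutative_of_isFrobeniusWith hsep F⟩,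
    ⟨q, r, K.prime_q, K.prime_r, K.prime_r_ne_prime_q.symm, K.prime_q_ne_prime_p,
      K.prime_r_ne_prime_p, K.primeFactors_card⟩, K.card_center⟩

end PrimeKernel

end Frobenius

/-! ### From the two components of the graph to the two parts U and V. -/

section Graph

variable {G : Type*} [Group G]

theorem mk_mem_noncenter_iff {x : G} :
    ConjClasses.mk x ∈ ConjClasses.noncenter G ↔ x ∉ Subgroup.center G := by
  rw [ConjClasses.mem_noncenter, ← Set.not_subsingleton_iff, not_iff_not, Subgroup.mem_center_iff]
  constructor
  · intro h g
    have h1 : g * x * g⁻¹ ∈ (ConjClasses.mk x).carrier :=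
      ConjClasses.mem_carrier_iff_mk_eq.2 (ConjClasses.mk_eq_mk_iff_isConj.2 (isConj_conj g x).symm)
    exact mul_inv_eq_iff_eq_mul.1 (h h1 ConjClasses.mem_carrier_mk)
  · intro h
    have h1 : ∀ y ∈ (ConjClasses.mk x).carrier, y = x := by
      intro y hy
      rw [ConjClasses.mem_carrier_iff_mk_eq, ConjClasses.mk_eq_mk_iff_isConj] at hy
      obtain ⟨g, rfl⟩ := isConj_iff.1 hy.symm
      rw [h g, mul_inv_cancel_right]
    exact fun y hy z hz => (h1 y hy).trans (h1 z hz).symm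

/-- The parts are the unions of the classes in each component. Coprimality across them holds because
non-coprime lengths would give equal or adjacent vertices. -/
theorem exists_classSplit {p : ℕ}
    (hcomp : Nat.card (pRegularClassGraph p G).ConnectedComponent = 2)
    (hpair : ∀ c : (pRegularClassGraph p G).ConnectedComponent,
      ∃ B D : PRegularNoncentralClass p G,
        (pRegularClassGraph p G).Adj B D ∧ c.supp = {B, D}) :
    ∃ U V : Set G, ClassSplit p U V := by
  obtain ⟨c₁, c₂, hne, huniv⟩ := Nat.card_eq_two_iff.1 hcomp
  let S : (pRegularClassGraph p G).ConnectedComponent → Set G := fun c =>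
    {x | ∃ v : PRegularNoncentralClass p G, v.1 = ConjClasses.mk x ∧ v ∈ c.supp}
  have hreg : ∀ c, ∀ x ∈ S c, ¬ p ∣ orderOf x := by
    rintro c x ⟨v, hv, -⟩
    exact v.2.2 x (hv ▸ ConjClasses.mem_carrier_mk)
  have hnon : ∀ c, ∀ x ∈ S c, x ∉ Subgroup.center G := by
    rintro c x ⟨v, hv, -⟩
    exact mk_mem_noncenter_iff.1 (hv ▸ v.2.1)
  have hthree : ∀ c, ∀ x ∈ S c, ∀ y ∈ S c, ∀ z ∈ S c, IsConj x y ∨ IsConj x z ∨ IsConj y z := by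
    rintro c x ⟨u, hu, huc⟩ y ⟨v, hv, hvc⟩ z ⟨w, hw, hwc⟩
    obtain ⟨B, D, -, hBD⟩ := hpair c
    rw [hBD] at huc hvc hwc
    simp only [← ConjClasses.mk_eq_mk_iff_isConj, ← hu, ← hv, ← hw]
    rcases huc with rfl | rfl <;> rcases hvc with rfl | rfl <;> rcases hwc with rfl | rfl <;> simp
  have hnonempty : ∀ c, (S c).Nonempty := by
    intro c
    obtain ⟨v, rfl⟩ := c.exists_rep
    obtain ⟨x, hx⟩ := v.1.exists_rep
    exact ⟨x, v, hx.symm, rfl⟩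
  refine ⟨S c₁, S c₂, hreg c₁, hreg c₂, hnon c₁, hnon c₂, ?_, ?_, hthree c₁, hthree c₂,
    hnonempty c₁, hnonempty c₂⟩
  · intro x hx hxc
    let v : PRegularNoncentralClass p G := ⟨ConjClasses.mk x, mk_mem_noncenter_iff.2 hxc, by
      intro g hg
      rw [ConjClasses.mem_carrier_iff_mk_eq, ConjClasses.mk_eq_mk_iff_isConj] at hg
      rwa [orderOf_eq_of_isConj hg]⟩
    have h1 : (pRegularClassGraph p G).connectedComponentMk v ∈ ({c₁, c₂} : Set _) :=
      huniv ▸ Set.mem_univ _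
    exact h1.imp (fun h => ⟨v, rfl, h⟩) fun h => ⟨v, rfl, h⟩
  · rintro x ⟨v, hv, hvc⟩ y ⟨w, hw, hwc⟩
    by_contra hcop
    refine hne ?_
    rw [← card_carrier_eq_classLength, ← card_carrier_eq_classLength, ← hv, ← hw] at hcop
    by_cases hvw : v = w
    · subst hvw
      exact hvc.symm.trans hwc
    · have hadj : (pRegularClassGraph p G).Adj v w := ⟨hvw, hcop⟩
      exact hvc.symm.trans ((SimpleGraph.ConnectedComponent.connectedComponentMk_eq_of_adj hadj).trans
        hwc)

end Graph

theorem mainTheorem8 {G : Type*} [Group G] [Finite G] (p : ℕ) (hp : p.Prime)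
    (hG : IsPSeparable p G) (H : Subgroup G) (hH : IsPComplement p H)
    (hcomp : Nat.card (pRegularClassGraph p G).ConnectedComponent = 2)
    (hpair : ∀ c : (pRegularClassGraph p G).ConnectedComponent,
      ∃ B D : PRegularNoncentralClass p G,
        (pRegularClassGraph p G).Adj B D ∧ c.supp = {B, D}) :
    (Subgroup.center H).map H.subtype = H ⊓ Subgroup.center G ∧
      IsQuasiFrobeniusAbelian H ∧
      (∃ q r : ℕ, q.Prime ∧ r.Prime ∧ q ≠ r ∧ q ≠ p ∧ r ≠ p ∧
        (Nat.card H).primeFactors = {q, r}) ∧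
      (Nat.card (Subgroup.center H) = 1 ∨
        (IsCyclic (Subgroup.center H) ∧ Nat.card (Subgroup.center H) = 2)) := by
  obtain ⟨U, V, S⟩ := exists_classSplit hcomp hpair
  obtain ⟨N, hN | hN⟩ := S.exists_splitKernel hp hH
  · obtain ⟨q, r, K⟩ := hN.exists_primeKernel hp
    exact K.conclusion hG
  · obtain ⟨q, r, K⟩ := hN.exists_primeKernel hp
    exact K.conclusion hG
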